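/- Let $\mathbb{K}$ be an algebraically closed field and let $Q$ be a quiver of type $A_n$ with an arbitrary orientation: its vertices are $1,\dots,n$, and for each $1\le k<n$ there is exactly one arrow between $k$ and $k+1$, in one of the two directions. For a dimension vector $\mathbf{d}\in\mathbb{N}^n$ let $R_{\mathbf{d}}(Q)=\bigoplus_{a:i\to j}\mathrm{Hom}_{\mathbb{K}}(\mathbb{K}^{d_i},\mathbb{K}^{d_j})$ be the space of representations of $Q$ of dimension vector $\mathbf{d}$, and put $$\mathrm{hom}(\mathbf{e},\mathbf{d})=\min\{\dim_{\mathbb{K}}\mathrm{Hom}_Q(U,V) : U\in R_{\mathbf{e}}(Q),\ V\in R_{\mathbf{d}}(Q)\}.$$ For $1\le i\le j\le n$ let $\alpha_{ij}$ be the dimension vector with entries $1$ at the vertices $i,\dots,j$ and $0$ elsewhere. For integers $a,b$ let $Q(a,b)$ be the full subquiver of $Q$ on the vertices $k$ of $Q$ with $a\le k\le b$ (empty if $a>b$). Let $Q^{\mathrm{so}}(i,j)$ be the set of sources of $Q(i,j)$, and let $Q^{\mathrm{si}}(i,j)=\{k_1<\dots<k_r\}$ be the set of those sinks of $Q(i-1,j+1)$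 that are different from $i$ and $j$. For $k\in Q^{\mathrm{si}}(i,j)$ let $w_k$ (resp. $u_k$) be the unique longest path in $Q(i,k)$ (resp. in $Q(k,j)$) ending in $k$; $w_k$ does not exist if $k=i-1$, and $u_k$ does not exist if $k=j+1$. Whenever they exist, these paths start in elements of $Q^{\mathrm{so}}(i,j)$. For $V\in R_{\mathbf{d}}(Q)$ and a path $p$ let $V_p$ be the composition of the maps of $V$ along $p$. Let $A_{ij}(V)$ be the block matrix with block rows indexed by $k\in Q^{\mathrm{si}}(i,j)$ and block columns indexed by $\ell\in Q^{\mathrm{so}}(i,j)$ (the block in position $(k,\ell)$ has size $d_k\times d_\ell$), whose block row $k$ contains $V_{w_k}$ in the column of the starting vertex of $w_k$, $V_{u_k}$ in the column of the starting vertex of $u_k$ (each if the path exists), and zeros elsewhere. Put $r_{ij}(V)=\mathrm{rank}\,A_{ij}(V)$. Then there is a rigid representation in $R_{\mathbf{d}}(Q)$, that is, a representation $V$ with $\mathrm{Ext}^1_Q(V,V)=0$. Let $V_{\mathbf{d},\mathrm{ri}}$ be any such representation. For every $V\in R_{\mathbf{d}}(Q)$: 1. $V\cong V_{\mathbf{d},\mathrm{ri}}$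 if and only if $$r_{ij}(V)=\sum_{\ell\in Q^{\mathrm{so}}(i,j)}d_\ell-\mathrm{hom}(\alpha_{ij},\mathbf{d})\quad\text{for all }1\le i\le j\le n.$$ 2. $V\cong V_{\mathbf{d},\mathrm{ri}}$ if and only if $V$ maximizes the rank tuple coordinatewise, that is, $r_{ij}(W)\le r_{ij}(V)$ for all $W\in R_{\mathbf{d}}(Q)$ and all $1\le i\le j\le n$. -/

import Mathlib

noncomputable section

open scoped Classical

namespace TypeA

/-! Quivers of type A with an arbitrary orientation. -/

/-- The vertex set of the quiver of type `A_n` with orientation `o`. The vertices are numbered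
`0, …, n - 1`; there are `n - 1` edges, the edge `e` joins the vertices `e` and `e + 1`, and it
points from `e` to `e + 1` if `o e = true`, and from `e + 1` to `e` if `o e = false`. -/
def Vertex (n : ℕ) (_o : Fin (n - 1) → Bool) : Type := Fin n

variable {n : ℕ} {o : Fin (n - 1) → Bool}

/-- The number of a vertex. -/
def Vertex.pos (v : Vertex n o) : ℕ := Fin.val (n := n) v

instance : Fintype (Vertex n o) := inferInstanceAs (Fintype (Fin n))

/-- The arrows `i ⟶ j` are the edges with tail `i` and head `j`. -/
instance : Quiver (Vertex n o) where
  Hom i j := {e : Fin (n - 1) //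
    if o e = true then i.pos = e.val ∧ j.pos = e.val + 1 else i.pos = e.val + 1 ∧ j.pos = e.val}

/-! Representations of a quiver. -/

section Representations

variable (K : Type*) [Field K] {Q : Type*} [Quiver Q]

/-- The space `R_d(Q)` of representations of the quiver `Q` on the vector spaces `K ^ (d i)`. -/
@[ext]
structure Rep (d : Q → ℕ) where
  /-- The linear map attached to an arrow. -/
  map : ∀ {i j : Q}, (i ⟶ j) → ((Fin (d i) → K) →ₗ[K] (Fin (d j) → K))

variable {K} {d e : Q → ℕ}

/-- The composition `V_p` of the maps of `V` along a path `p`. -/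
def Rep.along (V : Rep K d) {a : Q} :
    ∀ {b : Q}, Quiver.Path a b → ((Fin (d a) → K) →ₗ[K] (Fin (d b) → K))
  | _, .nil => LinearMap.id
  | _, .cons p f => V.map f ∘ₗ V.along p

/-- Two representations on the same vector spaces are isomorphic if they lie in the same orbit of
the base change group `∏ i, GL (K ^ (d i))`. -/
def Rep.Iso (V W : Rep K d) : Prop :=
  ∃ g : ∀ i : Q, (Fin (d i) → K) ≃ₗ[K] (Fin (d i) → K),
    ∀ {i j : Q} (a : i ⟶ j) (x : Fin (d i) → K), g j (V.map a x) = W.map a (g i x)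

/-- The differential `⨁ i, Hom_K(V_i, W_i) → ⨁ (a : i → j), Hom_K(V_i, W_j)`,
`(f_i) ↦ (f_j ∘ V_a - W_a ∘ f_i)`, of the standard two-term complex which computes
`Ext^•_Q(V, W)`. -/
def Rep.diff (V : Rep K e) (W : Rep K d) :
    (∀ i : Q, (Fin (e i) → K) →ₗ[K] (Fin (d i) → K)) →ₗ[K]
      (∀ (i j : Q), (i ⟶ j) → ((Fin (e i) → K) →ₗ[K] (Fin (d j) → K))) where
  toFun f := fun i j a => f j ∘ₗ V.map a - W.map a ∘ₗ f i
  map_add' f g := by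
    funext i j a
    ext x
    simp
    abel
  map_smul' c f := by
    funext i j a
    ext x
    simp [mul_sub]

/-- `Hom_Q(V, W)`: the families of linear maps `f_i : V_i → W_i` which satisfy
`f_j ∘ V_a = W_a ∘ f_i` for all arrows `a : i → j`. -/
def Rep.Hom (V : Rep K e) (W : Rep K d) :
    Submodule K (∀ i : Q, (Fin (e i) → K) →ₗ[K] (Fin (d i) → K)) :=
  LinearMap.ker (V.diff W)

/-- `Ext^1_Q(V, W)`, the first cohomology of the standard complex. -/
abbrev Rep.ExtOne (V : Rep K e) (W : Rep K d) : Type _ :=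
  (∀ (i j : Q), (i ⟶ j) → ((Fin (e i) → K) →ₗ[K] (Fin (d j) → K))) ⧸ LinearMap.range (V.diff W)

/-- A representation is rigid if its group of self-extensions vanishes. -/
def Rep.IsRigid (V : Rep K d) : Prop := Subsingleton (V.ExtOne V)

variable (K) in
/-- `hom(e, d)`: the minimal value of `dim Hom_Q(V, W)` for `V ∈ R_e(Q)` and `W ∈ R_d(Q)`. -/
def homMin (e d : Q → ℕ) : ℕ :=
  sInf {m : ℕ | ∃ (V : Rep K e) (W : Rep K d), Module.finrank K (V.Hom W) = m}

/-- `k` is a sink of the full subquiver with vertex set `S`. -/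
def IsSinkIn (S : Set Q) (k : Q) : Prop := k ∈ S ∧ ∀ l ∈ S, IsEmpty (k ⟶ l)

/-- `k` is a source of the full subquiver with vertex set `S`. -/
def IsSourceIn (S : Set Q) (k : Q) : Prop := k ∈ S ∧ ∀ l ∈ S, IsEmpty (l ⟶ k)

/-- `p` is a path in the full subquiver with vertex set `S`. -/
def IsPathIn (S : Set Q) {l k : Q} (p : Quiver.Path l k) : Prop := ∀ v ∈ p.vertices, v ∈ S

/-- `p` is a longest one among the paths that end in `k` and run in the full subquiver with
vertex set `S`. -/
def IsLongestPathIn (S : Set Q) {l k : Q} (p : Quiver.Path l k) : Prop :=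
  IsPathIn S p ∧ ∀ (l' : Q) (q : Quiver.Path l' k), IsPathIn S q → q.length ≤ p.length

/-- The map `V_p : V_l → V_k` if the longest path `p` in `S` ending in `k` starts in `l`, and zero
if there is no such path. -/
def Rep.longest (V : Rep K d) (S : Set Q) (k l : Q) : (Fin (d l) → K) →ₗ[K] (Fin (d k) → K) :=
  if h : ∃ p : Quiver.Path l k, IsLongestPathIn S p then V.along h.choose else 0

end Representations

/-! Rank tuples. -/

/-- The vertices of the full subquiver `Q(a, b)`; the bounds are integers, so that they may lie
outside of the range of the vertex numbers. -/
def segment (o : Fin (n - 1) → Bool) (a b : ℤ) : Set (Vertex n o) :=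
  {v | a ≤ (v.pos : ℤ) ∧ (v.pos : ℤ) ≤ b}

/-- The positive root `α_{ij}`. -/
def root (i j : Vertex n o) : Vertex n o → ℕ :=
  fun k => if i.pos ≤ k.pos ∧ k.pos ≤ j.pos then 1 else 0

/-- `Q^{si}(i, j)`: the sinks of `Q(i - 1, j + 1)` different from `i` and `j`. -/
def sinks (i j : Vertex n o) : Finset (Vertex n o) :=
  Finset.univ.filter fun k => IsSinkIn (segment o (i.pos - 1) (j.pos + 1)) k ∧ k ≠ i ∧ k ≠ j

/-- `Q^{so}(i, j)`: the sources of `Q(i, j)`. -/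
def sources (i j : Vertex n o) : Finset (Vertex n o) :=
  Finset.univ.filter fun l => IsSourceIn (segment o i.pos j.pos) l

variable {K : Type*} [Field K] {d : Vertex n o → ℕ}

/-- The block matrix `A_{ij}(V)`. Its block rows are indexed by `k ∈ Q^{si}(i, j)` and its block
columns by `l ∈ Q^{so}(i, j)`. The block row of `k` has the block `V_w` in the column of the start
of `w`, the longest path in `Q(i, k)` ending in `k`, the block `V_u` in the column of the start of
`u`, the longest path in `Q(k, j)` ending in `k`, and zero blocks elsewhere. For `k = i - 1` (resp.
`k = j + 1`) the quiver `Q(i, k)` (resp. `Q(k, j)`) is empty, and only the other block is there. -/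
def blockMatrix (V : Rep K d) (i j : Vertex n o) :
    Matrix (Σ k : sinks i j, Fin (d k)) (Σ l : sources i j, Fin (d l)) K :=
  fun x y => LinearMap.toMatrix'
    (V.longest (segment o i.pos x.1.1.pos) x.1.1 y.1.1 +
      V.longest (segment o x.1.1.pos j.pos) x.1.1 y.1.1) x.2 y.2

/-- `r_{ij}(V)`, the rank of `A_{ij}(V)`. -/
def rankTuple (V : Rep K d) (i j : Vertex n o) : ℕ := (blockMatrix V i j).rank

end TypeA

end

/-!
The block matrix `A_{ij}(V)` is the matrix of `Hom(-, V)` applied to a projective presentation of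
the indecomposable representation `M` with dimension vector `α_{ij}`, so its kernel is `Hom(M, V)`
and `r_{ij}(V) + dim Hom(M, V)` is the sum of the `d l` over the sources `l`
(`rankTuple_add_finrank_hom`). In `Rep.interval`, `M` is normalized by signs, because both blocks
in a row of `A_{ij}(V)` enter with a positive sign. Both claims are thus statements about the
numbers `dim Hom(M, V)`, which are to be compared with those of a rigid representation `R`.

*Rigid representations minimize homomorphism spaces.* If `R` is rigid, the differential of `R` is
surjective, so that the identity of `R` can be deformed to an isomorphism from `R` to almost every
point of a given line through `R` (`Rep.IsRigid.finite_not_iso_line`). Since the field is infinite, two rigid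
representations of the same dimension vector are isomorphic, and semicontinuity of ranks shows that
rigid representations, among them `R` and `M`, minimize the dimensions of homomorphism spaces. So
`hom(α_{ij}, d) = dim Hom(M, R) ≤ dim Hom(M, V)`.

*Rigidity is visible in flags.* Reading the quiver from left to right, each space `V_k` carries a
chain of subspaces, the images of the spaces of compatible families on the intervals which end in
`k` (`Zigzag.flag`). If every map is in general position with respect to the chain at its left end,
the equations for the vanishing of `Ext^1(V, V)` can be solved from left to right: by induction,
the endomorphisms of `V_k` which stabilize the chain extend to endomorphisms of the part of `V` to
the left of `k` (`Zigzag.IsGeneric.exists_solution`). An explicit representation by aligned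
identity matrices has this property (`standard_isGeneric`), so rigid representations exist.

*The converse.* General position is a condition on the dimensions of the members of the chains
(`Zigzag.isGeneric_iff`), and these dimensions are determined by the numbers `dim Hom(M, V)`
(`Zigzag.finrank_flag_eq`). So if these numbers agree with those of `R`, then `V` is rigid, and
hence isomorphic to `R` (`iso_of_finrank_hom_eq`). No decomposition into indecomposables is needed.
-/

noncomputable section

namespace TypeA

/-! ### Perturbations of linear maps -/

section Perturbation

variable {K : Type*} [Field K]

theorem finite_not_injective_id_add_smul {E : Type*} [AddCommGroup E] [Module K E]
    [FiniteDimensional K E] (N : E →ₗ[K] E) :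
    {t : K | ¬ Function.Injective (LinearMap.id + t • N : E →ₗ[K] E)}.Finite := by
  -- If `1 + t N` is singular, `-t⁻¹` is an eigenvalue of `N`.
  refine ((Module.End.finite_hasEigenvalue (f := N)).image fun μ => -μ⁻¹).subset ?_
  intro t ht
  have h1 : LinearMap.ker (LinearMap.id + t • N : E →ₗ[K] E) ≠ ⊥ := by
    rwa [Ne, LinearMap.ker_eq_bot]
  obtain ⟨v, hv, hv0⟩ := Submodule.exists_mem_ne_zero_of_ne_bot h1
  have hv' : v + t • N v = 0 := by simpa using hv
  have ht0 : t ≠ 0 := by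
    rintro rfl
    exact hv0 (by simpa using hv')
  refine ⟨-t⁻¹, ?_, by simp⟩
  refine Module.End.hasEigenvalue_of_hasEigenvector (x := v)
    (Module.End.hasEigenvector_iff.2 ⟨Module.End.mem_eigenspace_iff.2 ?_, hv0⟩)
  have h2 : t • N v = -v := by
    rw [eq_neg_iff_add_eq_zero, add_comm]; exact hv'
  rw [neg_smul, ← smul_neg, ← h2, smul_smul, inv_mul_cancel₀ ht0, one_smul]

/-- Lower semicontinuity of the rank along a line. -/
theorem finite_finrank_range_lt {E F : Type*} [AddCommGroup E] [Module K E]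
    [FiniteDimensional K E] [AddCommGroup F] [Module K F] (L₀ L₁ : E →ₗ[K] F) :
    {t : K | Module.finrank K (LinearMap.range (L₀ + t • L₁)) <
      Module.finrank K (LinearMap.range L₀)}.Finite := by
  obtain ⟨D, hD⟩ := L₀.rangeRestrict.exists_rightInverse_of_surjective L₀.range_rangeRestrict
  obtain ⟨C, hC⟩ := (LinearMap.range L₀).subtype.exists_leftInverse_of_injective
    (LinearMap.range L₀).ker_subtype
  -- For `t = 0` the composite `C ∘ (L₀ + t L₁) ∘ D` is the identity of the range of `L₀`.
  refine (finite_not_injective_id_add_smul (C ∘ₗ L₁ ∘ₗ D)).subset ?_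
  intro t ht hinj
  rw [Set.mem_ofPred_eq] at ht
  refine not_le_of_gt ht ?_
  have key : (LinearMap.id + t • (C ∘ₗ L₁ ∘ₗ D) : _ →ₗ[K] _) = C ∘ₗ (L₀ + t • L₁) ∘ₗ D := by
    have h0 : C ∘ₗ L₀ ∘ₗ D = LinearMap.id := by
      ext x
      have h1 : L₀ (D x) = x := by
        simpa using congrArg Subtype.val (LinearMap.congr_fun hD x)
      have h2 : C x = x := by simpa using LinearMap.congr_fun hC x
      simp [h1, h2]
    rw [LinearMap.add_comp, LinearMap.comp_add, h0, LinearMap.smul_comp, LinearMap.comp_smul]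
  rw [key] at hinj
  have h3 : Function.Injective ((L₀ + t • L₁) ∘ₗ D) := by
    rw [LinearMap.coe_comp] at hinj
    exact hinj.of_comp
  calc Module.finrank K (LinearMap.range L₀)
      = Module.finrank K (LinearMap.range ((L₀ + t • L₁) ∘ₗ D)) :=
        (LinearMap.finrank_range_of_inj h3).symm
    _ ≤ Module.finrank K (LinearMap.range (L₀ + t • L₁)) :=
        Submodule.finrank_mono (LinearMap.range_comp_le_range _ _)

/-- A function `K → K` which is given by a polynomial. -/
def IsPoly (g : K → K) : Prop := ∃ p : Polynomial K, ∀ t, g t = p.eval t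

theorem IsPoly.const (c : K) : IsPoly fun _ : K => c := ⟨Polynomial.C c, fun t => by simp⟩

theorem IsPoly.id : IsPoly fun t : K => t := ⟨Polynomial.X, fun t => by simp⟩

theorem IsPoly.add {f g : K → K} (hf : IsPoly f) (hg : IsPoly g) : IsPoly fun t => f t + g t := by
  obtain ⟨p, hp⟩ := hf
  obtain ⟨q, hq⟩ := hg
  exact ⟨p + q, fun t => by simp [hp, hq]⟩

theorem IsPoly.mul {f g : K → K} (hf : IsPoly f) (hg : IsPoly g) : IsPoly fun t => f t * g t := by
  obtain ⟨p, hp⟩ := hf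
  obtain ⟨q, hq⟩ := hg
  exact ⟨p * q, fun t => by simp [hp, hq]⟩

theorem IsPoly.sum {ι : Type*} (s : Finset ι) {f : ι → K → K} (hf : ∀ i, IsPoly (f i)) :
    IsPoly fun t => ∑ i ∈ s, f i t := by
  choose p hp using hf
  exact ⟨∑ i ∈ s, p i, fun t => by simp [hp, Polynomial.eval_finsetSum]⟩

theorem IsPoly.prod {ι : Type*} (s : Finset ι) {f : ι → K → K} (hf : ∀ i, IsPoly (f i)) :
    IsPoly fun t => ∏ i ∈ s, f i t := by
  choose p hp using hf
  exact ⟨∏ i ∈ s, p i, fun t => by simp [hp, Polynomial.eval_prod]⟩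

theorem IsPoly.det {ι : Type*} [Fintype ι] [DecidableEq ι] {A : K → Matrix ι ι K}
    (hA : ∀ i j, IsPoly fun t => A t i j) : IsPoly fun t => (A t).det := by
  simp only [Matrix.det_apply']
  exact .sum _ fun σ => (IsPoly.const _).mul (.prod _ fun i => hA _ _)

theorem IsPoly.adjugate {ι : Type*} [Fintype ι] [DecidableEq ι] {A : K → Matrix ι ι K}
    (hA : ∀ i j, IsPoly fun t => A t i j) (i j : ι) : IsPoly fun t => (A t).adjugate i j := by
  simp only [Matrix.adjugate_apply]
  refine .det fun k l => ?_
  by_cases hk : k = j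
  · subst hk
    simpa using IsPoly.const _
  · simpa [Matrix.updateRow_ne hk] using hA k l

theorem IsPoly.finite_zeros {g : K → K} (hg : IsPoly g) {t₀ : K} (h : g t₀ ≠ 0) :
    {t | g t = 0}.Finite := by
  classical
  obtain ⟨p, hp⟩ := hg
  have hp0 : p ≠ 0 := by
    rintro rfl
    exact h (by simp [hp])
  refine p.roots.toFinset.finite_toSet.subset fun t ht => ?_
  have : p.eval t = 0 := by rw [← hp]; exact ht
  simpa [hp0] using this

/-- The vector `(1 + t N)⁻¹ w`, multiplied by the determinant of `1 + t N`, depends polynomially on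
`t`, and it is `w` for `t = 0`. Hence the open condition that a given linear function of it is
an isomorphism persists for almost all `t`. -/
theorem exists_resolvent {W : Type*} [AddCommGroup W] [Module K W] [FiniteDimensional K W]
    (N : W →ₗ[K] W) (w : W) {ι : Type*} [Finite ι] (m : ι → ℕ)
    (ev : ∀ i, W →ₗ[K] ((Fin (m i) → K) →ₗ[K] (Fin (m i) → K)))
    (hw : ∀ i, Function.Bijective (ev i w)) :
    ∃ f : K → W, (∀ t, ∃ c : K, f t + t • N (f t) = c • w) ∧
      {t | ¬ ∀ i, Function.Bijective (ev i (f t))}.Finite := by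
  classical
  let b := Module.finBasis K W
  let A : K → Matrix _ _ K := fun t => LinearMap.toMatrix b b (LinearMap.id + t • N)
  let v : K → _ := fun t => (A t).adjugate.mulVec (b.repr w)
  have hA : ∀ i j, IsPoly fun t => A t i j := fun i j => by
    have : (fun t => A t i j) =
        fun t => (1 : Matrix _ _ K) i j + t * LinearMap.toMatrix b b N i j := by
      funext t
      simp [A]
    rw [this]
    exact (IsPoly.const _).add (IsPoly.id.mul (.const _))
  have hv : ∀ i, IsPoly fun t => v t i := fun i => by
    simp only [v, Matrix.mulVec, dotProduct]
    exact .sum _ fun j => (IsPoly.adjugate hA _ _).mul (.const _)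
  let f : K → W := fun t => ∑ i, v t i • b i
  have hrepr : ∀ t, ⇑(b.repr (f t)) = v t := fun t => by
    funext i
    simp [f, Finsupp.single_apply]
  have hf0 : f 0 = w := by
    have : v 0 = b.repr w := by simp [v, A]
    simp only [f, this]
    exact b.sum_repr w
  refine ⟨f, fun t => ⟨(A t).det, ?_⟩, ?_⟩
  · apply b.repr.injective
    ext i
    have h1 : (LinearMap.toMatrix b b (LinearMap.id + t • N)).mulVec (b.repr (f t)) =
        b.repr ((LinearMap.id + t • N : W →ₗ[K] W) (f t)) := LinearMap.toMatrix_mulVec_repr b b _ _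
    rw [hrepr] at h1
    have h2 : (A t).mulVec (v t) = (A t).det • (b.repr w : _ → K) := by
      simp [v, Matrix.mulVec_mulVec, Matrix.mul_adjugate, Matrix.smul_mulVec]
    have h3 := congrFun (h1.symm.trans h2) i
    simpa using h3
  · have hset : {t | ¬ ∀ i, Function.Bijective (ev i (f t))} ⊆
        ⋃ i, {t | (LinearMap.toMatrix' (ev i (f t))).det = 0} := by
      intro t ht
      simp only [Set.mem_ofPred_eq, not_forall] at ht
      obtain ⟨i, hi⟩ := ht
      refine Set.mem_iUnion.2 ⟨i, ?_⟩
      by_contra hdet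
      have hdet' : LinearMap.det (ev i (f t)) ≠ 0 := by
        rw [← LinearMap.det_toMatrix']; exact hdet
      exact hi ((LinearMap.equivOfDetNeZero _ hdet').bijective)
    refine (Set.finite_iUnion fun i => ?_).subset hset
    refine IsPoly.finite_zeros (t₀ := 0) (.det fun p q => ?_) ?_
    · simp only [f, map_sum, map_smul, Matrix.sum_apply, Matrix.smul_apply, smul_eq_mul]
      exact .sum _ fun k => (hv k).mul (.const _)
    · rw [hf0, LinearMap.det_toMatrix']
      exact (LinearEquiv.ofBijective (ev i w) (hw i)).isUnit_det'.ne_zero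

end Perturbation

/-! ### Rigid representations of a finite quiver -/

section Rigid

variable {K : Type*} [Field K] {Q : Type*} [Quiver Q] {d e : Q → ℕ}

theorem Rep.isRigid_iff (V : Rep K d) : V.IsRigid ↔ ∀ g, ∃ f, V.diff V f = g := by
  unfold Rep.IsRigid Rep.ExtOne
  rw [Submodule.Quotient.subsingleton_iff, LinearMap.range_eq_top]
  rfl

theorem Rep.mem_hom {V : Rep K e} {W : Rep K d}
    {f : ∀ i : Q, (Fin (e i) → K) →ₗ[K] (Fin (d i) → K)} :
    f ∈ V.Hom W ↔ ∀ (i j : Q) (a : i ⟶ j), f j ∘ₗ V.map a = W.map a ∘ₗ f i := by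
  unfold Rep.Hom Rep.diff
  rw [LinearMap.mem_ker]
  constructor
  · intro h i j a
    exact sub_eq_zero.1 (congrFun (congrFun (congrFun h i) j) a)
  · intro h
    funext i j a
    exact sub_eq_zero.2 (h i j a)

theorem Rep.Iso.refl (V : Rep K d) : V.Iso V :=
  ⟨fun _ => LinearEquiv.refl K _, fun _ _ => rfl⟩

theorem Rep.Iso.symm {V W : Rep K d} (h : V.Iso W) : W.Iso V := by
  obtain ⟨g, hg⟩ := h
  refine ⟨fun i => (g i).symm, fun {i j} a x => ?_⟩
  rw [LinearEquiv.symm_apply_eq, hg]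
  simp

theorem Rep.Iso.trans {U V W : Rep K d} (h : U.Iso V) (h' : V.Iso W) : U.Iso W := by
  obtain ⟨g, hg⟩ := h
  obtain ⟨g', hg'⟩ := h'
  exact ⟨fun i => (g i).trans (g' i), fun {i j} a x => by simp [hg, hg']⟩

theorem Rep.iso_of_mem_hom {V W : Rep K d} {f} (hf : f ∈ V.Hom W)
    (h : ∀ i, Function.Bijective (f i)) : V.Iso W :=
  ⟨fun i => LinearEquiv.ofBijective (f i) (h i), fun {i j} a x =>
    LinearMap.congr_fun (Rep.mem_hom.1 hf i j a) x⟩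

/-- Isomorphic representations have isomorphic homomorphism spaces. -/
theorem Rep.finrank_hom_congr {U U' : Rep K e} {V V' : Rep K d} (hU : U.Iso U') (hV : V.Iso V') :
    Module.finrank K (U.Hom V) = Module.finrank K (U'.Hom V') := by
  obtain ⟨g, hg⟩ := hU
  obtain ⟨h, hh⟩ := hV
  let Φ : (∀ i : Q, (Fin (e i) → K) →ₗ[K] (Fin (d i) → K)) ≃ₗ[K]
      (∀ i : Q, (Fin (e i) → K) →ₗ[K] (Fin (d i) → K)) :=
    LinearEquiv.piCongrRight fun i => LinearEquiv.arrowCongr (g i) (h i)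
  have hΦ : ∀ f i x, Φ f i x = h i (f i ((g i).symm x)) := fun f i x => rfl
  have hmap : (U.Hom V).map (Φ : _ →ₗ[K] _) = U'.Hom V' := by
    ext f
    rw [Submodule.mem_map_equiv, Rep.mem_hom, Rep.mem_hom]
    have hs : ∀ i x, Φ.symm f i x = (h i).symm (f i (g i x)) := fun i x => rfl
    refine forall_congr' fun i => forall_congr' fun j => forall_congr' fun a => ?_
    rw [LinearMap.ext_iff, LinearMap.ext_iff]
    refine ((g i).toEquiv.forall_congr (fun {x} => ?_))
    simp only [LinearMap.comp_apply, hs, LinearEquiv.symm_apply_eq]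
    rw [hg, hh]
    simp
  rw [← hmap]
  exact (LinearEquiv.finrank_map_eq Φ _).symm

/-- The point with parameter `t` on the line through `V` and `W`. -/
def Rep.line (V W : Rep K d) (t : K) : Rep K d where
  map a := (1 - t) • V.map a + t • W.map a

theorem Rep.line_symm (V W : Rep K d) (t : K) : V.line W (1 - t) = W.line V t := by
  simp [Rep.line, add_comm]

theorem Rep.diff_line (U U' : Rep K e) (V V' : Rep K d) (t : K) :
    (U.line U' t).diff (V.line V' t) = (1 - t) • U.diff V + t • U'.diff V' := by
  refine LinearMap.ext fun f => ?_
  funext i j a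
  refine LinearMap.ext fun x => ?_
  simp only [Rep.line, Rep.diff, LinearMap.coe_mk, AddHom.coe_mk, LinearMap.sub_apply,
    LinearMap.add_apply, LinearMap.smul_apply, LinearMap.comp_apply, Pi.add_apply, Pi.smul_apply,
    map_add, map_smul]
  module

variable [Finite Q]

/-- A rigid representation is isomorphic to almost all points of every line through it. Since the
differential of `R` is surjective, the equation `f ∈ Hom(R, R_t)` can be solved for `f` with `f`
near the identity. -/
theorem Rep.IsRigid.finite_not_iso_line {R : Rep K d} (hR : R.IsRigid) (V : Rep K d) :
    {t : K | ¬ R.Iso (R.line V t)}.Finite := by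
  have hsurj : LinearMap.range (R.diff R) = ⊤ :=
    LinearMap.range_eq_top.2 fun g => (Rep.isRigid_iff R).1 hR g
  obtain ⟨S, hS⟩ := (R.diff R).exists_rightInverse_of_surjective hsurj
  -- As `R.diff R ∘ S = 1`, the differential of `(R, R_t)` is
  -- `R.diff R + t L₁ = R.diff R ∘ (1 + t S L₁)`, and the identity lies in the kernel of `R.diff R`.
  let L₁ := R.diff V - R.diff R
  obtain ⟨f, hf, hfin⟩ := exists_resolvent (S ∘ₗ L₁) (fun i => LinearMap.id) d
    (fun i => LinearMap.proj i) (fun i => Function.bijective_id)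
  refine hfin.subset fun t ht hbij => ht (Rep.iso_of_mem_hom (f := f t) ?_ hbij)
  obtain ⟨c, hc⟩ := hf t
  have h0 : R.line R t = R := by
    cases R
    simp [Rep.line, ← add_smul]
  have h1 : R.diff R (fun i => LinearMap.id) = 0 := by
    funext i j a
    simp [Rep.diff]
  have h2 : R.diff R (S (L₁ (f t))) = L₁ (f t) := LinearMap.congr_fun hS _
  have h3 := congrArg (R.diff R) hc
  rw [map_smul, h1, smul_zero, map_add, map_smul, LinearMap.comp_apply, h2] at h3
  have h4 := Rep.diff_line R R R V t
  rw [h0] at h4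
  rw [Rep.Hom, LinearMap.mem_ker, h4, ← h3]
  simp only [L₁, LinearMap.add_apply, LinearMap.smul_apply, LinearMap.sub_apply]
  module

variable [Infinite K]

theorem Rep.IsRigid.iso {R R' : Rep K d} (hR : R.IsRigid) (hR' : R'.IsRigid) : R.Iso R' := by
  have h1 := hR.finite_not_iso_line R'
  have h2 := (hR'.finite_not_iso_line R).image fun t => 1 - t
  obtain ⟨t, ht⟩ := (h1.union h2).exists_notMem
  simp only [Set.mem_union, not_or, Set.mem_image, Set.mem_ofPred_eq, not_not, not_exists,
    not_and] at ht
  have h3 : R'.Iso (R'.line R (1 - t)) := by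
    by_contra h
    exact ht.2 _ h (by ring)
  rw [Rep.line_symm] at h3
  exact ht.1.trans h3.symm

/-- Rigid representations have the smallest possible homomorphism spaces. -/
theorem Rep.IsRigid.finrank_hom_le {U₀ : Rep K e} {V₀ : Rep K d} (hU : U₀.IsRigid)
    (hV : V₀.IsRigid) (U : Rep K e) (V : Rep K d) :
    Module.finrank K (U₀.Hom V₀) ≤ Module.finrank K (U.Hom V) := by
  have h1 := hU.finite_not_iso_line U
  have h2 := hV.finite_not_iso_line V
  have h3 := (finite_finrank_range_lt (U.diff V) (U₀.diff V₀ - U.diff V)).image fun t => 1 - t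
  obtain ⟨t, ht⟩ := ((h1.union h2).union h3).exists_notMem
  simp only [Set.mem_union, not_or, Set.mem_image, Set.mem_ofPred_eq, not_not, not_exists,
    not_and] at ht
  obtain ⟨⟨hU', hV'⟩, h4⟩ := ht
  have h5 : Module.finrank K (LinearMap.range (U.diff V)) ≤
      Module.finrank K (LinearMap.range ((U₀.line U t).diff (V₀.line V t))) := by
    have h6 : (U₀.line U t).diff (V₀.line V t) =
        U.diff V + (1 - t) • (U₀.diff V₀ - U.diff V) := by
      rw [Rep.diff_line]
      module
    rw [h6]
    by_contra h
    exact h4 (1 - t) (not_le.1 h) (by ring)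
  rw [Rep.finrank_hom_congr hU' hV']
  have h7 := LinearMap.finrank_range_add_finrank_ker (U.diff V)
  have h8 := LinearMap.finrank_range_add_finrank_ker ((U₀.line U t).diff (V₀.line V t))
  unfold Rep.Hom
  omega

theorem Rep.IsRigid.homMin_eq {U : Rep K e} {V : Rep K d} (hU : U.IsRigid) (hV : V.IsRigid) :
    homMin K e d = Module.finrank K (U.Hom V) := by
  refine le_antisymm (Nat.sInf_le ⟨U, V, rfl⟩) ?_
  obtain ⟨U', V', h⟩ := Nat.sInf_mem
    (⟨_, U, V, rfl⟩ : {m : ℕ | ∃ (V : Rep K e) (W : Rep K d),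
      Module.finrank K (V.Hom W) = m}.Nonempty)
  rw [homMin, ← h]
  exact hU.finrank_hom_le hV U' V'

end Rigid

/-! ### Complements compatible with a chain of subspaces -/

section Chain

variable {K : Type*} [Field K] {E E' : Type*} [AddCommGroup E] [Module K E]
  [AddCommGroup E'] [Module K E'] {ι : Type*} [Finite ι]

theorem exists_isCompl_comparable {S : ι → Submodule K E}
    (hchain : ∀ i j, S i ≤ S j ∨ S j ≤ S i) {N : Submodule K E}
    (hS : ∀ i, Disjoint (S i) N ∨ Codisjoint (S i) N) :
    ∃ C, IsCompl C N ∧ ∀ i, S i ≤ C ∨ C ≤ S i := by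
  -- `A` is the largest member of the chain which is disjoint from `N`, or `⊥`.
  obtain ⟨A, hAN, hA, hA'⟩ : ∃ A, Disjoint A N ∧ (∀ i, Disjoint (S i) N → S i ≤ A) ∧
      ∀ i, ¬ Disjoint (S i) N → A ≤ S i := by
    by_cases hne : {i | Disjoint (S i) N}.Nonempty
    · obtain ⟨m, hm⟩ := Set.Finite.exists_maximalFor S _ (Set.toFinite _) hne
      have hmN : Disjoint (S m) N := hm.prop
      refine ⟨S m, hmN, fun i hi => ?_, fun i hi => ?_⟩
      · exact (hchain i m).elim id fun h => hm.le_of_le hi h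
      · exact (hchain m i).elim id fun h => (hi (hmN.mono_left h)).elim
    · refine ⟨⊥, disjoint_bot_left, fun i hi => (hne ⟨i, hi⟩).elim, fun i _ => bot_le⟩
  -- `B` is the smallest of the other members, or `⊤`.
  obtain ⟨B, hBN, hB, hAB⟩ : ∃ B, Codisjoint B N ∧ (∀ i, ¬ Disjoint (S i) N → B ≤ S i) ∧
      A ≤ B := by
    by_cases hne : {i | ¬ Disjoint (S i) N}.Nonempty
    · obtain ⟨m, hm⟩ := Set.Finite.exists_minimalFor S _ (Set.toFinite _) hne
      have hmN : ¬ Disjoint (S m) N := hm.prop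
      refine ⟨S m, (hS m).resolve_left hmN, fun i hi => ?_, hA' m hmN⟩
      exact (hchain m i).elim id fun h => hm.le_of_le hi h
    · exact ⟨⊤, codisjoint_top_left, fun i hi => (hne ⟨i, hi⟩).elim, le_top⟩
  obtain ⟨C, hAC, hC⟩ : ∃ C, A ≤ C ∧ IsCompl C (N ⊓ B) := by
    obtain ⟨C, h1, h2⟩ := (hAN.mono_right (inf_le_left : N ⊓ B ≤ N)).exists_isCompl
    exact ⟨C, h1, h2⟩
  refine ⟨C ⊓ B, ⟨?_, ?_⟩, fun i => ?_⟩
  · rw [disjoint_iff, inf_assoc, inf_comm B N]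
    exact hC.inf_eq_bot
  · rw [codisjoint_iff, eq_top_iff, ← hBN.eq_top]
    refine sup_le ?_ le_sup_right
    have h1 : B = (C ⊓ B) ⊔ (N ⊓ B) := by
      rw [inf_comm C B, inf_sup_assoc_of_le _ (inf_le_right : N ⊓ B ≤ B), hC.sup_eq_top,
        inf_top_eq]
    calc B = (C ⊓ B) ⊔ (N ⊓ B) := h1
      _ ≤ (C ⊓ B) ⊔ N := sup_le_sup_left inf_le_left _
  · by_cases hi : Disjoint (S i) N
    · exact Or.inl ((hA i hi).trans (le_inf hAC hAB))
    · exact Or.inr (inf_le_right.trans (hB i hi))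

/-- The stabilizer of a chain in `E` and the full endomorphism algebra of `E'` act on `Hom(E, E')`.
If `φ` is generic with respect to the chain, the orbit of `φ` is infinitesimally everything, and
each endomorphism of `E'` which stabilizes the image of the chain lifts to the stabilizer. -/
theorem exists_stabilizer_of_map {S : ι → Submodule K E}
    (hchain : ∀ i j, S i ≤ S j ∨ S j ≤ S i) (htop : ∃ i, S i = ⊤) {φ : E →ₗ[K] E'}
    (hS : ∀ i, Disjoint (S i) (LinearMap.ker φ) ∨ (S i).map φ = ⊤) :
    (∀ x : E' →ₗ[K] E', (∀ i, (S i).map φ ≤ ((S i).map φ).comap x) →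
      ∃ y : E →ₗ[K] E, (∀ i, S i ≤ (S i).comap y) ∧ φ ∘ₗ y = x ∘ₗ φ) ∧
    ∀ g : E →ₗ[K] E', ∃ (x : E' →ₗ[K] E') (y : E →ₗ[K] E), (∀ i, S i ≤ (S i).comap y) ∧
      x ∘ₗ φ - φ ∘ₗ y = g := by
  obtain ⟨C, hC, hcomp⟩ := exists_isCompl_comparable hchain (N := LinearMap.ker φ) fun i =>
    (hS i).imp id fun h => by
      rw [codisjoint_iff, ← Submodule.comap_map_eq, h, Submodule.comap_top]
  have hker : LinearMap.ker (φ ∘ₗ C.subtype) = ⊥ := by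
    rw [LinearMap.ker_comp, ← Submodule.disjoint_iff_comap_eq_bot]
    exact hC.disjoint
  obtain ⟨s₀, hs₀⟩ := (φ ∘ₗ C.subtype).exists_leftInverse_of_injective hker
  -- `s ∘ φ` is the projection onto `C` along the kernel of `φ`.
  let s : E' →ₗ[K] E := C.subtype ∘ₗ s₀
  have hs : ∀ c ∈ C, s (φ c) = c := fun c hc =>
    congrArg Subtype.val (LinearMap.congr_fun hs₀ ⟨c, hc⟩)
  have hsC : ∀ v, s v ∈ C := fun v => (s₀ v).2
  have hφ : ∀ v, φ (s (φ v)) = φ v := fun v => by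
    obtain ⟨c, hc, m, hm, rfl⟩ := Submodule.mem_sup.1
      (hC.sup_eq_top ▸ Submodule.mem_top : v ∈ C ⊔ LinearMap.ker φ)
    rw [map_add, LinearMap.mem_ker.1 hm, add_zero, hs c hc]
  constructor
  · intro x hx
    obtain ⟨i₀, hi₀⟩ := htop
    have hxr : ∀ v, ∃ w, φ w = x (φ v) := fun v => by
      obtain ⟨w, -, hw⟩ := hx i₀ (Submodule.mem_map_of_mem (hi₀ ▸ Submodule.mem_top : v ∈ S i₀))
      exact ⟨w, hw⟩
    refine ⟨s ∘ₗ x ∘ₗ φ, fun i v hv => ?_, LinearMap.ext fun v => ?_⟩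
    · change s (x (φ v)) ∈ S i
      obtain h | h := hcomp i
      · obtain ⟨w, hw, hw'⟩ := hx i (Submodule.mem_map_of_mem hv)
        rw [← hw', hs w (h hw)]
        exact hw
      · exact h (hsC _)
    · obtain ⟨w, hw⟩ := hxr v
      simp only [LinearMap.comp_apply]
      rw [← hw, hφ]
  · intro g
    refine ⟨g ∘ₗ s, s ∘ₗ g ∘ₗ (s ∘ₗ φ - LinearMap.id), fun i v hv => ?_,
      LinearMap.ext fun v => ?_⟩
    · change s (g (s (φ v) - v)) ∈ S i
      obtain h | h := hcomp i
      · rw [hs v (h hv), sub_self, map_zero, map_zero]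
        exact zero_mem _
      · exact h (hsC _)
    · change g (s (φ v)) - φ (s (g (s (φ v) - v))) = g v
      obtain ⟨i₀, hi₀⟩ := htop
      obtain h | h := hS i₀
      · have hv : s (φ v) = v := by
          rw [hi₀, top_disjoint, LinearMap.ker_eq_bot] at h
          exact h (hφ v)
        rw [hv, sub_self]
        simp
      · obtain ⟨w, -, hw⟩ : g (s (φ v) - v) ∈ (S i₀).map φ := h ▸ Submodule.mem_top
        rw [← hw, hφ, hw, map_sub]
        abel

/-- The version of `exists_stabilizer_of_map` for a map into the space with the chain. -/
theorem exists_stabilizer_of_comap {S : ι → Submodule K E}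
    (hchain : ∀ i j, S i ≤ S j ∨ S j ≤ S i) {φ : E' →ₗ[K] E}
    (hφ : LinearMap.ker φ = ⊥ ∨ LinearMap.range φ = ⊤)
    (hS : ∀ i, Disjoint (S i) (LinearMap.range φ) ∨ Codisjoint (S i) (LinearMap.range φ)) :
    (∀ x : E' →ₗ[K] E', (∀ i, (S i).comap φ ≤ ((S i).comap φ).comap x) →
      LinearMap.ker φ ≤ (LinearMap.ker φ).comap x →
      ∃ y : E →ₗ[K] E, (∀ i, S i ≤ (S i).comap y) ∧ y ∘ₗ φ = φ ∘ₗ x) ∧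
    ∀ g : E' →ₗ[K] E, ∃ (x : E' →ₗ[K] E') (y : E →ₗ[K] E), (∀ i, S i ≤ (S i).comap y) ∧
      φ ∘ₗ x - y ∘ₗ φ = g := by
  obtain ⟨C, hC, hcomp⟩ := exists_isCompl_comparable hchain hS
  obtain ⟨r, hr⟩ := φ.rangeRestrict.exists_rightInverse_of_surjective φ.range_rangeRestrict
  have hr' : ∀ w, φ (r w) = w := fun w => congrArg Subtype.val (LinearMap.congr_fun hr w)
  -- `φ ∘ s` is the projection onto the range of `φ` along `C`.
  let s : E →ₗ[K] E' := r ∘ₗ Submodule.projectionOnto _ _ hC.symm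
  have hs0 : ∀ c ∈ C, s c = 0 := fun c hc => by
    change r _ = 0
    rw [show Submodule.projectionOnto _ _ hC.symm c = 0 from
      Submodule.projectionOnto_apply_right hC.symm ⟨c, hc⟩, map_zero]
  have hsN : ∀ v, φ (s (φ v)) = φ v := fun v => by
    change φ (r _) = _
    rw [show Submodule.projectionOnto _ _ hC.symm (φ v) = ⟨φ v, v, rfl⟩ from
      Submodule.projectionOnto_apply_left hC.symm ⟨φ v, v, rfl⟩, hr']
  have hsC : ∀ v, φ (s v) - v ∈ C := fun v => by
    obtain ⟨c, hc, m, ⟨w, rfl⟩, rfl⟩ := Submodule.mem_sup.1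
      (hC.sup_eq_top ▸ Submodule.mem_top : v ∈ C ⊔ LinearMap.range φ)
    rw [map_add, hs0 c hc, zero_add, hsN]
    simpa using hc
  constructor
  · intro x hx hxk
    refine ⟨φ ∘ₗ x ∘ₗ s, fun i v hv => ?_, LinearMap.ext fun v => ?_⟩
    · change φ (x (s v)) ∈ S i
      obtain h | h := hcomp i
      · rw [hs0 v (h hv)]
        simp
      · refine hx i (show φ (s v) ∈ S i from ?_)
        have := add_mem (h (hsC v)) hv
        simpa using this
    · change φ (x (s (φ v))) = φ (x v)
      have h1 : s (φ v) - v ∈ LinearMap.ker φ := by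
        rw [LinearMap.mem_ker, map_sub, hsN, sub_self]
      have h2 : φ (x (s (φ v) - v)) = 0 := hxk h1
      rw [map_sub, map_sub, sub_eq_zero] at h2
      exact h2
  · intro g
    refine ⟨s ∘ₗ g, (φ ∘ₗ s - LinearMap.id) ∘ₗ g ∘ₗ s, fun i v hv => ?_,
      LinearMap.ext fun v => ?_⟩
    · change φ (s (g (s v))) - g (s v) ∈ S i
      obtain h | h := hcomp i
      · rw [hs0 v (h hv)]
        simp
      · exact h (hsC _)
    · change φ (s (g v)) - (φ (s (g (s (φ v)))) - g (s (φ v))) = g v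
      obtain h | h := hφ
      · have hv : s (φ v) = v := LinearMap.ker_eq_bot.1 h (hsN v)
        rw [hv]
        abel
      · obtain ⟨w, hw⟩ : g v ∈ LinearMap.range φ := h ▸ Submodule.mem_top
        obtain ⟨w', hw'⟩ : g (s (φ v)) ∈ LinearMap.range φ := h ▸ Submodule.mem_top
        rw [← hw, ← hw', hsN, hsN]
        abel

end Chain

open scoped Classical

/-! ### Zigzags of vector spaces and their flags -/

section Zigzag

/-- A pair of opposite maps between `E k` and `E (k + 1)` for every `k`. It is used together with
a predicate `b` on `ℕ`, the set of those `k` for which the map `up k` counts; for the others the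
map `dn k` does. -/
structure Zigzag (K : Type*) [Field K] (E : ℕ → Type*) [∀ k, AddCommGroup (E k)]
    [∀ k, Module K (E k)] where
  /-- The map from `E k` to `E (k + 1)`. -/
  up : ∀ k, E k →ₗ[K] E (k + 1)
  /-- The map from `E (k + 1)` to `E k`. -/
  dn : ∀ k, E (k + 1) →ₗ[K] E k

variable {K : Type*} [Field K] {E : ℕ → Type*} [∀ k, AddCommGroup (E k)] [∀ k, Module K (E k)]

/-- The subspace of `E k` which comes from the vertex `a ≤ k`: the vectors which extend to a
compatible family on `a, …, k` that is annihilated by the map from `E a` to `E (a - 1)`, if there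
is one. -/
def Zigzag.flag (Z : Zigzag K E) (b : ℕ → Prop) (a : ℕ) : ∀ k, Submodule K (E k)
  | 0 => ⊤
  | k + 1 =>
    if a ≤ k then
      if b k then (Z.flag b a k).map (Z.up k) else (Z.flag b a k).comap (Z.dn k)
    else if b k then ⊤ else LinearMap.ker (Z.dn k)

variable {Z : Zigzag K E} {b : ℕ → Prop} {a a' k : ℕ}

theorem Zigzag.flag_succ_of_up (hk : b k) (ha : a ≤ k) :
    Z.flag b a (k + 1) = (Z.flag b a k).map (Z.up k) := by
  simp [Zigzag.flag, hk, ha]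

theorem Zigzag.flag_succ_of_dn (hk : ¬ b k) (ha : a ≤ k) :
    Z.flag b a (k + 1) = (Z.flag b a k).comap (Z.dn k) := by
  simp [Zigzag.flag, hk, ha]

theorem Zigzag.flag_self_of_up (hk : b k) : Z.flag b (k + 1) (k + 1) = ⊤ := by
  simp [Zigzag.flag, hk]

theorem Zigzag.flag_self_of_dn (hk : ¬ b k) :
    Z.flag b (k + 1) (k + 1) = LinearMap.ker (Z.dn k) := by
  simp [Zigzag.flag, hk]

theorem Zigzag.flag_le_or_le (k : ℕ) : ∀ {a a' : ℕ}, a ≤ k → a' ≤ k →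
    Z.flag b a k ≤ Z.flag b a' k ∨ Z.flag b a' k ≤ Z.flag b a k := by
  induction k with
  | zero => intro a a' _ _; exact Or.inl le_rfl
  | succ k ih =>
    intro a a' ha ha'
    by_cases hk : b k
    · obtain rfl | ha := Nat.eq_or_lt_of_le ha
      · exact Or.inr (by rw [flag_self_of_up hk]; exact le_top)
      obtain rfl | ha' := Nat.eq_or_lt_of_le ha'
      · exact Or.inl (by rw [flag_self_of_up hk]; exact le_top)
      rw [flag_succ_of_up hk (Nat.le_of_lt_succ ha), flag_succ_of_up hk (Nat.le_of_lt_succ ha')]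
      exact (ih (Nat.le_of_lt_succ ha) (Nat.le_of_lt_succ ha')).imp
        (Submodule.map_mono ·) (Submodule.map_mono ·)
    · have hker : ∀ c ≤ k, Z.flag b (k + 1) (k + 1) ≤ Z.flag b c (k + 1) := fun c hc => by
        rw [flag_self_of_dn hk, flag_succ_of_dn hk hc]
        exact LinearMap.ker_le_comap _
      obtain rfl | ha := Nat.eq_or_lt_of_le ha
      · obtain rfl | ha' := Nat.eq_or_lt_of_le ha'
        · exact Or.inl le_rfl
        · exact Or.inl (hker _ (Nat.le_of_lt_succ ha'))
      obtain rfl | ha' := Nat.eq_or_lt_of_le ha'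
      · exact Or.inr (hker _ (Nat.le_of_lt_succ ha))
      rw [flag_succ_of_dn hk (Nat.le_of_lt_succ ha), flag_succ_of_dn hk (Nat.le_of_lt_succ ha')]
      exact (ih (Nat.le_of_lt_succ ha) (Nat.le_of_lt_succ ha')).imp
        (Submodule.comap_mono ·) (Submodule.comap_mono ·)

theorem Zigzag.exists_flag_eq_top (k : ℕ) : ∃ a ≤ k, Z.flag b a k = ⊤ := by
  induction k with
  | zero => exact ⟨0, le_rfl, rfl⟩
  | succ k ih =>
    by_cases hk : b k
    · exact ⟨k + 1, le_rfl, flag_self_of_up hk⟩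
    · obtain ⟨a, ha, h⟩ := ih
      exact ⟨a, ha.trans k.le_succ, by rw [flag_succ_of_dn hk ha, h, Submodule.comap_top]⟩

variable (Z b) in
/-- A zigzag is generic below `N` if each of its maps is in general position with respect to the
flag at its left end. -/
def Zigzag.IsGeneric (N : ℕ) : Prop :=
  ∀ k, k + 1 < N →
    (b k → ∀ a ≤ k, Disjoint (Z.flag b a k) (LinearMap.ker (Z.up k)) ∨
      (Z.flag b a k).map (Z.up k) = ⊤) ∧
    (¬ b k → (LinearMap.ker (Z.dn k) = ⊥ ∨ LinearMap.range (Z.dn k) = ⊤) ∧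
      ∀ a ≤ k, Disjoint (Z.flag b a k) (LinearMap.range (Z.dn k)) ∨
        Codisjoint (Z.flag b a k) (LinearMap.range (Z.dn k)))

/-- For a generic zigzag the equations which say that `(g, g')` is a coboundary can be solved from
left to right: a solution on `0, …, k` exists, and its last component can be changed by any
endomorphism which stabilizes the flag. -/
theorem Zigzag.IsGeneric.exists_solution {N : ℕ} (hZ : Z.IsGeneric b N)
    (g : ∀ k, E k →ₗ[K] E (k + 1)) (g' : ∀ k, E (k + 1) →ₗ[K] E k) (k : ℕ) (hk : k < N) :
    ∃ z : E k →ₗ[K] E k, ∀ y : E k →ₗ[K] E k,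
      (∀ a ≤ k, Z.flag b a k ≤ (Z.flag b a k).comap y) →
      ∃ f : ∀ l, E l →ₗ[K] E l, f k = z + y ∧ ∀ l < k,
        (b l → f (l + 1) ∘ₗ Z.up l - Z.up l ∘ₗ f l = g l) ∧
        (¬ b l → f l ∘ₗ Z.dn l - Z.dn l ∘ₗ f (l + 1) = g' l) := by
  induction k with
  | zero => exact ⟨0, fun y _ => ⟨Function.update 0 0 y, by simp, fun l hl => by omega⟩⟩
  | succ k ih =>
    obtain ⟨z, hz⟩ := ih (by omega)
    let S : Fin (k + 1) → Submodule K (E k) := fun a => Z.flag b a k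
    have hchain : ∀ i j, S i ≤ S j ∨ S j ≤ S i := fun i j =>
      flag_le_or_le k (by omega) (by omega)
    have htop : ∃ i, S i = ⊤ := by
      obtain ⟨a, ha, h⟩ := Z.exists_flag_eq_top (b := b) k
      exact ⟨⟨a, by omega⟩, h⟩
    -- It suffices to have a suitable pair of endomorphisms of `E k` and `E (k + 1)`.
    have key : ∀ (f : ∀ l, E l →ₗ[K] E l) (x : E (k + 1) →ₗ[K] E (k + 1)),
        (b k → x ∘ₗ Z.up k - Z.up k ∘ₗ f k = g k) →
        (¬ b k → f k ∘ₗ Z.dn k - Z.dn k ∘ₗ x = g' k) →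
        (∀ l < k, (b l → f (l + 1) ∘ₗ Z.up l - Z.up l ∘ₗ f l = g l) ∧
          (¬ b l → f l ∘ₗ Z.dn l - Z.dn l ∘ₗ f (l + 1) = g' l)) →
        ∃ f : ∀ l, E l →ₗ[K] E l, f (k + 1) = x ∧ ∀ l < k + 1,
          (b l → f (l + 1) ∘ₗ Z.up l - Z.up l ∘ₗ f l = g l) ∧
          (¬ b l → f l ∘ₗ Z.dn l - Z.dn l ∘ₗ f (l + 1) = g' l) := by
      intro f x h1 h2 h3
      refine ⟨Function.update f (k + 1) x, by simp, fun l hl => ?_⟩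
      rw [Function.update_of_ne (by omega : l ≠ k + 1)]
      obtain rfl | hl := Nat.eq_or_lt_of_le (Nat.le_of_lt_succ hl)
      · rw [Function.update_self]
        exact ⟨h1, h2⟩
      · rw [Function.update_of_ne (by omega : l + 1 ≠ k + 1)]
        exact h3 l hl
    by_cases hb : b k
    · obtain ⟨hlift, hsolve⟩ := exists_stabilizer_of_map hchain htop
        (fun i => ((hZ k hk).1 hb i (by omega)))
      obtain ⟨x₀, y₀, hy₀, h₀⟩ := hsolve (g k + Z.up k ∘ₗ z)
      refine ⟨x₀, fun y hy => ?_⟩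
      obtain ⟨y₁, hy₁, h₁⟩ := hlift y fun i => by
        have := hy i (by omega)
        rwa [flag_succ_of_up hb (by omega)] at this
      obtain ⟨f, hf, hf'⟩ := hz (y₀ + y₁) fun a ha v hv =>
        (Z.flag b a k).add_mem (x := y₀ v) (y := y₁ v) (hy₀ ⟨a, by omega⟩ hv)
          (hy₁ ⟨a, by omega⟩ hv)
      refine key f (x₀ + y) (fun _ => ?_) (fun h => (h hb).elim) hf'
      rw [hf, LinearMap.comp_add, LinearMap.comp_add, h₁, LinearMap.add_comp]
      rw [sub_eq_iff_eq_add] at h₀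
      rw [h₀]
      abel
    · obtain ⟨hlift, hsolve⟩ := exists_stabilizer_of_comap hchain ((hZ k hk).2 hb).1
        (fun i => (((hZ k hk).2 hb).2 i (by omega)))
      obtain ⟨x₀, y₀, hy₀, h₀⟩ := hsolve (z ∘ₗ Z.dn k - g' k)
      refine ⟨x₀, fun y hy => ?_⟩
      obtain ⟨y₁, hy₁, h₁⟩ := hlift y (fun i => by
          have := hy i (by omega)
          rwa [flag_succ_of_dn hb (by omega)] at this) (by
        have := hy (k + 1) le_rfl
        rwa [flag_self_of_dn hb] at this)
      obtain ⟨f, hf, hf'⟩ := hz (y₀ + y₁) fun a ha v hv =>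
        (Z.flag b a k).add_mem (x := y₀ v) (y := y₁ v) (hy₀ ⟨a, by omega⟩ hv)
          (hy₁ ⟨a, by omega⟩ hv)
      refine key f (x₀ + y) (fun h => (hb h).elim) (fun _ => ?_) hf'
      rw [hf, LinearMap.comp_add, LinearMap.add_comp, LinearMap.add_comp, h₁]
      rw [sub_eq_iff_eq_add] at h₀
      rw [h₀]
      abel

end Zigzag

/-! ### Compatible families and the dimensions of flags -/

section Dimension

variable {K : Type*} [Field K]

theorem finrank_map_add_finrank_inf_ker {M M' : Type*} [AddCommGroup M] [Module K M]
    [FiniteDimensional K M] [AddCommGroup M'] [Module K M'] (S : Submodule K M) (f : M →ₗ[K] M') :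
    Module.finrank K (S.map f) + Module.finrank K (S ⊓ LinearMap.ker f : Submodule K M) =
      Module.finrank K S := by
  rw [← LinearMap.finrank_range_add_finrank_ker (f.domRestrict S), LinearMap.range_domRestrict,
    LinearMap.ker_domRestrict, ← Submodule.map_comap_subtype S (LinearMap.ker f),
    Submodule.finrank_map_subtype_eq]

theorem finrank_comap_eq {M M' : Type*} [AddCommGroup M] [Module K M]
    [FiniteDimensional K M] [AddCommGroup M'] [Module K M'] (S : Submodule K M') (f : M →ₗ[K] M') :
    Module.finrank K (S.comap f) = Module.finrank K (S ⊓ LinearMap.range f : Submodule K M') +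
      Module.finrank K (LinearMap.ker f) := by
  rw [← finrank_map_add_finrank_inf_ker (S.comap f) f, Submodule.map_comap_eq, inf_comm,
    inf_of_le_right (LinearMap.ker_le_comap f)]

variable {E : ℕ → Type*} [∀ k, AddCommGroup (E k)] [∀ k, Module K (E k)]

/-- The families of vectors supported on `a, …, k` which are compatible, up to the scalars `c`,
with all maps between neighbours in this interval, and which are annihilated by the map from
`E a` to `E (a - 1)`, if there is one. -/
def Zigzag.family (Z : Zigzag K E) (b : ℕ → Prop) (c : ℕ → K) (a k : ℕ) :
    Submodule K (∀ l, E l) where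
  carrier := {x | (∀ l, l < a ∨ k < l → x l = 0) ∧ ∀ e < k,
    (b e → a ≤ e → Z.up e (x e) = c e • x (e + 1)) ∧
    (¬ b e → a ≤ e + 1 → Z.dn e (x (e + 1)) = c e • x e)}
  zero_mem' := by simp
  add_mem' := by
    rintro x y ⟨hx, hx'⟩ ⟨hy, hy'⟩
    refine ⟨fun l hl => by simp [hx l hl, hy l hl], fun e he => ⟨fun h1 h2 => ?_, fun h1 h2 => ?_⟩⟩
    · simp [(hx' e he).1 h1 h2, (hy' e he).1 h1 h2]
    · simp [(hx' e he).2 h1 h2, (hy' e he).2 h1 h2]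
  smul_mem' := by
    rintro t x ⟨hx, hx'⟩
    refine ⟨fun l hl => by simp [hx l hl], fun e he => ⟨fun h1 h2 => ?_, fun h1 h2 => ?_⟩⟩
    · simp [(hx' e he).1 h1 h2, smul_comm t]
    · simp [(hx' e he).2 h1 h2, smul_comm t]

/-- The compatible families which are also annihilated by the map from `E k` to `E (k + 1)`, if
there is one. -/
def Zigzag.closedFamily (Z : Zigzag K E) (b : ℕ → Prop) (c : ℕ → K) (a k : ℕ) :
    Submodule K (∀ l, E l) :=
  Z.family b c a k ⊓ if b k then LinearMap.ker (Z.up k ∘ₗ LinearMap.proj k) else ⊤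

/-- The linear map which replaces the component at `k` by zero. -/
def truncate (K : Type*) [Field K] (E : ℕ → Type*) [∀ k, AddCommGroup (E k)]
    [∀ k, Module K (E k)] (k : ℕ) : (∀ l, E l) →ₗ[K] (∀ l, E l) where
  toFun x := Function.update x k 0
  map_add' x y := by
    funext l
    by_cases h : l = k
    · subst h; simp
    · simp [h]
  map_smul' t x := by
    funext l
    by_cases h : l = k
    · subst h; simp
    · simp [h]

@[simp] theorem truncate_self (k : ℕ) (x : ∀ l, E l) : truncate K E k x k = 0 := by
  simp [truncate]

theorem truncate_of_ne {k l : ℕ} (h : l ≠ k) (x : ∀ l, E l) : truncate K E k x l = x l := by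
  simp [truncate, h]

variable {Z : Zigzag K E} {b : ℕ → Prop} {c : ℕ → K} {a k : ℕ}

theorem Zigzag.mem_family_succ (ha : a ≤ k) {x : ∀ l, E l} :
    x ∈ Z.family b c a (k + 1) ↔ truncate K E (k + 1) x ∈ Z.family b c a k ∧
      (∀ l, k + 1 < l → x l = 0) ∧
      (b k → Z.up k (x k) = c k • x (k + 1)) ∧ (¬ b k → Z.dn k (x (k + 1)) = c k • x k) := by
  have hne : ∀ e < k, truncate K E (k + 1) x e = x e ∧
      truncate K E (k + 1) x (e + 1) = x (e + 1) := fun e he =>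
    ⟨truncate_of_ne (by omega) x, truncate_of_ne (by omega) x⟩
  constructor
  · rintro ⟨h1, h2⟩
    refine ⟨⟨fun l hl => ?_, fun e he => ?_⟩, fun l hl => h1 l (Or.inr hl),
      fun h => (h2 k k.lt_succ_self).1 h ha, fun h => (h2 k k.lt_succ_self).2 h (by omega)⟩
    · obtain rfl | hl' := eq_or_ne l (k + 1)
      · simp
      · rw [truncate_of_ne hl']
        exact h1 l (by omega)
    · rw [(hne e he).1, (hne e he).2]
      exact h2 e (by omega)
  · rintro ⟨⟨h1, h2⟩, h0, h3, h4⟩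
    refine ⟨fun l hl => ?_, fun e he => ?_⟩
    · obtain hl | hl := hl
      · rw [← h1 l (Or.inl hl), truncate_of_ne (by omega)]
      · exact h0 l hl
    · obtain rfl | he := Nat.eq_or_lt_of_le (Nat.le_of_lt_succ he)
      · exact ⟨fun h _ => h3 h, fun h _ => h4 h⟩
      · have := h2 e he
        rwa [(hne e he).1, (hne e he).2] at this

theorem Zigzag.family_eq_zero {x : ∀ l, E l} (hx : x ∈ Z.family b c a k) {l : ℕ}
    (hl : l < a ∨ k < l) : x l = 0 := hx.1 l hl

theorem Zigzag.update_mem_family_succ (ha : a ≤ k) {x : ∀ l, E l} (hx : x ∈ Z.family b c a k)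
    {v : E (k + 1)} (h1 : b k → Z.up k (x k) = c k • v) (h2 : ¬ b k → Z.dn k v = c k • x k) :
    Function.update x (k + 1) v ∈ Z.family b c a (k + 1) := by
  refine (mem_family_succ ha).2 ⟨?_, fun l hl => ?_, by simpa using h1, by simpa using h2⟩
  · have : truncate K E (k + 1) (Function.update x (k + 1) v) = x := by
      have h0 := family_eq_zero hx (Or.inr k.lt_succ_self)
      simp [truncate, ← h0]
    rwa [this]
  · rw [Function.update_of_ne (by omega)]
    exact family_eq_zero hx (by omega)

theorem Zigzag.single_mem_family {v : E k}
    (hv : ∀ e (h : e + 1 = k), ¬ b e → Z.dn e (h ▸ v) = 0) :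
    Pi.single k v ∈ Z.family b c k k := by
  refine ⟨fun l hl => Pi.single_eq_of_ne (by omega) v, fun e he => ⟨fun _ _ => by omega,
    fun h1 h2 => ?_⟩⟩
  obtain rfl : e + 1 = k := by omega
  rw [Pi.single_eq_same, Pi.single_eq_of_ne (by omega), smul_zero]
  exact hv e rfl h1

/-- The flag consists of the last components of the compatible families. -/
theorem Zigzag.map_proj_family (hc : ∀ e, c e ≠ 0) (k : ℕ) : ∀ {a : ℕ}, a ≤ k →
    (Z.family b c a k).map (LinearMap.proj k) = Z.flag b a k := by
  induction k with
  | zero =>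
    intro a ha
    obtain rfl : a = 0 := by omega
    refine eq_top_iff.2 fun v _ => ⟨Pi.single 0 v, single_mem_family fun e h => by omega, ?_⟩
    simp
  | succ k ih =>
    intro a ha
    ext v
    simp only [Submodule.mem_map, LinearMap.proj_apply]
    obtain rfl | ha := Nat.eq_or_lt_of_le ha
    · by_cases hk : b k
      · rw [flag_self_of_up hk]
        refine iff_of_true
          ⟨Pi.single (k + 1) v, single_mem_family fun e h hb => ?_, by simp⟩ trivial
        obtain rfl : e = k := by omega
        exact (hb hk).elim
      · rw [flag_self_of_dn hk, LinearMap.mem_ker]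
        constructor
        · rintro ⟨x, hx, rfl⟩
          rw [(hx.2 k k.lt_succ_self).2 hk le_rfl, family_eq_zero hx (Or.inl k.lt_succ_self),
            smul_zero]
        · intro hv
          refine ⟨Pi.single (k + 1) v, single_mem_family fun e h hb => ?_, by simp⟩
          obtain rfl : e = k := by omega
          exact hv
    · replace ha := Nat.le_of_lt_succ ha
      have hrestr : ∀ x ∈ Z.family b c a (k + 1), x k ∈ Z.flag b a k := fun x hx => by
        rw [← ih ha]
        refine ⟨_, ((mem_family_succ ha).1 hx).1, ?_⟩
        rw [LinearMap.proj_apply, truncate_of_ne (by omega)]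
      by_cases hk : b k
      · rw [flag_succ_of_up hk ha]
        constructor
        · rintro ⟨x, hx, rfl⟩
          refine ⟨(c k)⁻¹ • x k, Submodule.smul_mem _ _ (hrestr x hx), ?_⟩
          rw [map_smul, ((mem_family_succ ha).1 hx).2.2.1 hk, smul_smul, inv_mul_cancel₀ (hc k),
            one_smul]
        · rintro ⟨w, hw, rfl⟩
          have hw' := hw
          rw [SetLike.mem_coe, ← ih ha] at hw'
          obtain ⟨x, hx, rfl⟩ := hw'
          refine ⟨Function.update (c k • x) (k + 1) (Z.up k (x k)),
            update_mem_family_succ ha (Submodule.smul_mem _ _ hx) (fun _ => by simp)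
              (fun h => (h hk).elim), by simp⟩
      · rw [flag_succ_of_dn hk ha]
        constructor
        · rintro ⟨x, hx, rfl⟩
          rw [Submodule.mem_comap, ((mem_family_succ ha).1 hx).2.2.2 hk]
          exact Submodule.smul_mem _ _ (hrestr x hx)
        · intro hv
          rw [Submodule.mem_comap, ← ih ha] at hv
          obtain ⟨x, hx, hxv⟩ := hv
          refine ⟨Function.update ((c k)⁻¹ • x) (k + 1) v,
            update_mem_family_succ ha (Submodule.smul_mem _ _ hx) (fun h => (hk h).elim)
              (fun _ => ?_), by simp⟩
          rw [Pi.smul_apply, smul_smul, mul_inv_cancel₀ (hc k), one_smul]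
          exact hxv.symm

theorem Zigzag.closedFamily_of_dn (hk : ¬ b k) :
    Z.closedFamily b c a k = Z.family b c a k := by
  simp [Zigzag.closedFamily, hk]

theorem Zigzag.mem_closedFamily_of_up (hk : b k) {x : ∀ l, E l} :
    x ∈ Z.closedFamily b c a k ↔ x ∈ Z.family b c a k ∧ Z.up k (x k) = 0 := by
  simp [Zigzag.closedFamily, hk]

theorem Zigzag.family_succ_inf_ker_of_up (hk : b k) (ha : a ≤ k) :
    Z.family b c a (k + 1) ⊓ LinearMap.ker (LinearMap.proj (k + 1) : (∀ l, E l) →ₗ[K] E (k + 1)) =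
      Z.closedFamily b c a k := by
  ext x
  rw [Submodule.mem_inf, mem_family_succ ha, mem_closedFamily_of_up hk, LinearMap.mem_ker,
    LinearMap.proj_apply]
  constructor
  · rintro ⟨⟨h1, h0, h2, -⟩, h3⟩
    have : truncate K E (k + 1) x = x := by simp [truncate, ← h3]
    exact ⟨this ▸ h1, by rw [h2 hk, h3, smul_zero]⟩
  · rintro ⟨h1, h2⟩
    have h3 := family_eq_zero h1 (Or.inr k.lt_succ_self)
    have : truncate K E (k + 1) x = x := by simp [truncate, ← h3]
    refine ⟨⟨this.symm ▸ h1, fun l hl => family_eq_zero h1 (by omega), fun _ => ?_,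
      fun h => (h hk).elim⟩, h3⟩
    rw [h2, h3, smul_zero]

theorem Zigzag.family_succ_inf_ker_of_dn (hc : ∀ e, c e ≠ 0) (hk : ¬ b k) (ha : a ≤ k) :
    Z.family b c a (k + 1) ⊓ LinearMap.ker (LinearMap.proj (k + 1) : (∀ l, E l) →ₗ[K] E (k + 1)) =
      Z.family b c a k ⊓ LinearMap.ker (LinearMap.proj k : (∀ l, E l) →ₗ[K] E k) := by
  ext x
  rw [Submodule.mem_inf, mem_family_succ ha, Submodule.mem_inf, LinearMap.mem_ker,
    LinearMap.proj_apply, LinearMap.mem_ker, LinearMap.proj_apply]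
  constructor
  · rintro ⟨⟨h1, h0, -, h2⟩, h3⟩
    have : truncate K E (k + 1) x = x := by simp [truncate, ← h3]
    refine ⟨this ▸ h1, ?_⟩
    have h4 := h2 hk
    rw [h3, map_zero] at h4
    exact (smul_eq_zero.1 h4.symm).resolve_left (hc k)
  · rintro ⟨h1, h2⟩
    have h3 := family_eq_zero h1 (Or.inr k.lt_succ_self)
    have : truncate K E (k + 1) x = x := by simp [truncate, ← h3]
    refine ⟨⟨this.symm ▸ h1, fun l hl => family_eq_zero h1 (by omega), fun h => (hk h).elim,
      fun _ => ?_⟩, h3⟩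
    rw [h2, h3, smul_zero, map_zero]

/-- Genericity depends only on the dimensions of the members of the flags. -/
theorem Zigzag.isGeneric_iff [∀ k, FiniteDimensional K (E k)] {N : ℕ} :
    Z.IsGeneric b N ↔ ∀ k, k + 1 < N →
      (b k → ∀ a ≤ k,
        Module.finrank K (Z.flag b a (k + 1)) = Module.finrank K (Z.flag b a k) ∨
        Module.finrank K (Z.flag b a (k + 1)) = Module.finrank K (E (k + 1))) ∧
      (¬ b k → (Module.finrank K (Z.flag b (k + 1) (k + 1)) = 0 ∨
          Module.finrank K (Z.flag b (k + 1) (k + 1)) + Module.finrank K (E k) =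
            Module.finrank K (E (k + 1))) ∧
        ∀ a ≤ k, Module.finrank K (Z.flag b a (k + 1)) =
            Module.finrank K (Z.flag b (k + 1) (k + 1)) ∨
          Module.finrank K (Z.flag b a (k + 1)) + Module.finrank K (E k) =
            Module.finrank K (Z.flag b a k) + Module.finrank K (E (k + 1))) := by
  refine forall_congr' fun k => imp_congr_right fun _ => and_congr
    (forall_congr' fun hk => forall_congr' fun a => imp_congr_right fun ha => ?_)
    (forall_congr' fun hk => and_congr ?_
      (forall_congr' fun a => imp_congr_right fun ha => ?_))
  · rw [flag_succ_of_up hk ha]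
    have h1 := finrank_map_add_finrank_inf_ker (Z.flag b a k) (Z.up k)
    refine or_congr ?_ ⟨fun h => by rw [h, finrank_top], Submodule.eq_top_of_finrank_eq⟩
    rw [disjoint_iff, ← Submodule.finrank_eq_zero (R := K)]
    omega
  · rw [flag_self_of_dn hk]
    have h1 := LinearMap.finrank_range_add_finrank_ker (Z.dn k)
    refine or_congr (Submodule.finrank_eq_zero).symm ⟨fun h => ?_, fun h => ?_⟩
    · rw [h, finrank_top] at h1
      omega
    · exact Submodule.eq_top_of_finrank_eq (by omega)
  · rw [flag_self_of_dn hk, flag_succ_of_dn hk ha]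
    have h1 := LinearMap.finrank_range_add_finrank_ker (Z.dn k)
    have h2 := finrank_comap_eq (Z.flag b a k) (Z.dn k)
    have h3 := Submodule.finrank_sup_add_finrank_inf_eq (Z.flag b a k) (LinearMap.range (Z.dn k))
    refine or_congr ?_ ?_
    · rw [disjoint_iff, ← Submodule.finrank_eq_zero (R := K)]
      omega
    · rw [codisjoint_iff]
      refine ⟨fun h => ?_, fun h => Submodule.eq_top_of_finrank_eq (by omega)⟩
      rw [h, finrank_top] at h3
      omega

variable [FiniteDimensional K (∀ l, E l)]

theorem Zigzag.finrank_family_succ_of_up (hc : ∀ e, c e ≠ 0) (hk : b k) (ha : a ≤ k) :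
    Module.finrank K (Z.family b c a (k + 1)) = Module.finrank K (Z.family b c a k) := by
  have h1 : (Z.family b c a (k + 1)).map (truncate K E (k + 1)) = Z.family b c a k := by
    ext x
    constructor
    · rintro ⟨y, hy, rfl⟩
      exact ((mem_family_succ ha).1 hy).1
    · intro hx
      refine ⟨Function.update x (k + 1) ((c k)⁻¹ • Z.up k (x k)),
        update_mem_family_succ ha hx (fun _ => ?_) (fun h => (h hk).elim), ?_⟩
      · rw [smul_smul, mul_inv_cancel₀ (hc k), one_smul]
      · have h0 := family_eq_zero hx (Or.inr k.lt_succ_self)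
        simp [truncate, ← h0]
  have h2 : Z.family b c a (k + 1) ⊓ LinearMap.ker (truncate K E (k + 1)) = ⊥ := by
    rw [eq_bot_iff]
    rintro x ⟨hx, hx'⟩
    have h3 : ∀ l, l ≠ k + 1 → x l = 0 := fun l hl => by
      rw [← truncate_of_ne (K := K) hl x, LinearMap.mem_ker.1 hx', Pi.zero_apply]
    rw [Submodule.mem_bot]
    funext l
    obtain rfl | hl := eq_or_ne l (k + 1)
    · have h4 := ((mem_family_succ ha).1 hx).2.2.1 hk
      rw [h3 k (by omega), map_zero] at h4
      exact (smul_eq_zero.1 h4.symm).resolve_left (hc k)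
    · exact h3 l hl
  have := finrank_map_add_finrank_inf_ker (Z.family b c a (k + 1)) (truncate K E (k + 1))
  rw [h1, h2, finrank_bot, add_zero] at this
  exact this.symm

/-- The dimensions of the members of the flags are determined by the dimensions of the spaces of
closed families. Indeed the member of the flag at `k + 1` is the image of the families on
`a, …, k + 1`. The families which vanish at `k + 1` are the closed families on `a, …, k` if the
last map points to the right, and the families on `a, …, k` which vanish at `k` otherwise. -/
theorem Zigzag.finrank_flag_eq {Z Z' : Zigzag K E} (hc : ∀ e, c e ≠ 0) {N : ℕ}
    (hb : ∀ k, N ≤ k + 1 → ¬ b k)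
    (h : ∀ a k, a ≤ k → k < N → Module.finrank K (Z.closedFamily b c a k) =
      Module.finrank K (Z'.closedFamily b c a k)) (k : ℕ) (hk : k < N) :
    ∀ {a : ℕ}, a ≤ k → Module.finrank K (Z.flag b a k) = Module.finrank K (Z'.flag b a k) := by
  -- The dimensions of the spaces of families, from right to left.
  have hfam : ∀ m k, N = k + 1 + m → ∀ a ≤ k, Module.finrank K (Z.family b c a k) =
      Module.finrank K (Z'.family b c a k) := by
    intro m
    induction m with
    | zero =>
      intro k hk a ha
      have := h a k ha (by omega)
      rwa [closedFamily_of_dn (hb k (by omega)), closedFamily_of_dn (hb k (by omega))] at this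
    | succ m ih =>
      intro k hk a ha
      by_cases hbk : b k
      · rw [← finrank_family_succ_of_up hc hbk ha, ← finrank_family_succ_of_up hc hbk ha]
        exact ih (k + 1) (by omega) a (by omega)
      · have := h a k ha (by omega)
        rwa [closedFamily_of_dn hbk, closedFamily_of_dn hbk] at this
  have hflag : ∀ (Z : Zigzag K E) {a k}, a ≤ k → Module.finrank K (Z.flag b a k) +
      Module.finrank K (Z.family b c a k ⊓
        LinearMap.ker (LinearMap.proj k : (∀ l, E l) →ₗ[K] E k) : Submodule K _) =
      Module.finrank K (Z.family b c a k) := fun Z a k ha => by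
    rw [← map_proj_family hc k ha]
    exact finrank_map_add_finrank_inf_ker _ _
  induction k with
  | zero =>
    intro a ha
    rfl
  | succ k ih =>
    intro a ha
    have h1 := hflag Z ha
    have h2 := hflag Z' ha
    have h3 := hfam (N - (k + 1) - 1) (k + 1) (by omega) a ha
    obtain rfl | ha := Nat.eq_or_lt_of_le ha
    · have h0 : ∀ Z : Zigzag K E, Z.family b c (k + 1) (k + 1) ⊓ LinearMap.ker
          (LinearMap.proj (k + 1) : (∀ l, E l) →ₗ[K] E (k + 1)) = ⊥ := fun Z => by
        rw [eq_bot_iff]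
        rintro x ⟨hx, hx'⟩
        rw [Submodule.mem_bot]
        funext l
        obtain rfl | hl := eq_or_ne l (k + 1)
        · exact hx'
        · exact family_eq_zero hx (by omega)
      rw [h0, finrank_bot] at h1 h2
      omega
    · replace ha := Nat.le_of_lt_succ ha
      by_cases hbk : b k
      · rw [family_succ_inf_ker_of_up hbk ha] at h1 h2
        have := h a k ha (by omega)
        omega
      · rw [family_succ_inf_ker_of_dn hc hbk ha] at h1 h2
        have h4 := hflag Z ha
        have h5 := hflag Z' ha
        have h6 := hfam (N - k - 1) k (by omega) a ha
        have h7 := ih (by omega) ha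
        omega

end Dimension

/-! ### Representations as zigzags -/

section ToZigzag

variable {n : ℕ} {o : Fin (n - 1) → Bool}

variable (o) in
/-- The vertex with number `k`. -/
def vtx (k : ℕ) (h : k < n) : Vertex n o := (⟨k, h⟩ : Fin n)

variable (o) in
/-- The edge with number `e` exists and points from `e` to `e + 1`. -/
def IsUp (e : ℕ) : Prop := ∃ h : e < n - 1, o ⟨e, h⟩ = true

/-- The arrow from `e` to `e + 1`. -/
def upArrow {e : ℕ} (h : e + 1 < n) (he : IsUp o e) :
    vtx o e (e.lt_succ_self.trans h) ⟶ vtx o (e + 1) h :=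
  ⟨⟨e, by omega⟩, by
    obtain ⟨h1, h2⟩ := he
    rw [if_pos h2]
    exact ⟨rfl, rfl⟩⟩

/-- The arrow from `e + 1` to `e`. -/
def dnArrow {e : ℕ} (h : e + 1 < n) (he : ¬ IsUp o e) :
    vtx o (e + 1) h ⟶ vtx o e (e.lt_succ_self.trans h) :=
  ⟨⟨e, by omega⟩, by
    rw [if_neg fun h2 => he ⟨_, h2⟩]
    exact ⟨rfl, rfl⟩⟩

theorem arrow_induction {motive : ∀ i j : Vertex n o, (i ⟶ j) → Prop}
    (up : ∀ e (h : e + 1 < n) (he : IsUp o e), motive _ _ (upArrow h he))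
    (dn : ∀ e (h : e + 1 < n) (he : ¬ IsUp o e), motive _ _ (dnArrow h he))
    (i j : Vertex n o) (a : i ⟶ j) : motive i j a := by
  obtain ⟨i, hi⟩ : Fin n := i
  obtain ⟨j, hj⟩ : Fin n := j
  obtain ⟨⟨e, he⟩, ha⟩ := a
  by_cases ho : o ⟨e, he⟩ = true
  · have ha' := ha
    rw [if_pos ho] at ha'
    obtain ⟨h1, h2⟩ : i = e ∧ j = e + 1 := ha'
    subst h1 h2
    exact up i hj ⟨he, ho⟩
  · have ha' := ha
    rw [if_neg ho] at ha'
    obtain ⟨h1, h2⟩ : i = e + 1 ∧ j = e := ha'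
    subst h1 h2
    exact dn j hi fun ⟨_, h⟩ => ho h

theorem Vertex.pos_lt (v : Vertex n o) : v.pos < n := Fin.isLt (n := n) v

@[simp] theorem pos_vtx {k : ℕ} (h : k < n) : (vtx o k h).pos = k := rfl

theorem vtx_induction {motive : Vertex n o → Prop} (h : ∀ k hk, motive (vtx o k hk))
    (v : Vertex n o) : motive v := h v.pos v.pos_lt

theorem not_isUp {e : ℕ} (h : n ≤ e + 1) : ¬ IsUp o e := fun ⟨h', _⟩ => by omega

/-- The space `K ^ (d k)` at the vertex with number `k`, and zero if there is no such vertex. -/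
abbrev Space (K : Type*) (d : Vertex n o → ℕ) (k : ℕ) : Type _ :=
  ∀ h : PLift (k < n), Fin (d (vtx o k h.down)) → K

variable {K : Type*} [Field K] {d : Vertex n o → ℕ}

/-- A representation, as a zigzag. The map of an edge which points in the other direction is set
to zero. -/
def Rep.toZigzag (V : Rep K d) : Zigzag K (Space K d) where
  up e :=
    { toFun := fun x h => if he : IsUp o e then
        V.map (upArrow h.down he) (x ⟨e.lt_succ_self.trans h.down⟩) else 0
      map_add' := fun x y => by funext h; split_ifs <;> simp_all
      map_smul' := fun t x => by funext h; split_ifs <;> simp_all }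
  dn e :=
    { toFun := fun x h => if he : e + 1 < n ∧ ¬ IsUp o e then
        V.map (dnArrow he.1 he.2) (x ⟨he.1⟩) else 0
      map_add' := fun x y => by funext h; split_ifs <;> simp_all
      map_smul' := fun t x => by funext h; split_ifs <;> simp_all }

theorem Rep.toZigzag_up (V : Rep K d) {e : ℕ} (he : IsUp o e) (x : Space K d e)
    (h : PLift (e + 1 < n)) : V.toZigzag.up e x h =
      V.map (upArrow h.down he) (x ⟨e.lt_succ_self.trans h.down⟩) := by
  simp [Rep.toZigzag, he]

theorem Rep.toZigzag_dn (V : Rep K d) {e : ℕ} (he : ¬ IsUp o e) (he' : e + 1 < n)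
    (x : Space K d (e + 1)) (h : PLift (e < n)) : V.toZigzag.dn e x h =
      V.map (dnArrow he' he) (x ⟨he'⟩) := by
  simp [Rep.toZigzag, he, he']

instance : FiniteDimensional K (∀ k, Space K d k) :=
  Module.Finite.of_surjective
    ({ toFun := fun y k h => y (vtx o k h.down)
       map_add' := fun _ _ => rfl
       map_smul' := fun _ _ => rfl } : (∀ v : Vertex n o, Fin (d v) → K) →ₗ[K] ∀ k, Space K d k)
    fun x => ⟨fun v => x v.pos ⟨v.pos_lt⟩, rfl⟩

instance (k : ℕ) : FiniteDimensional K (Space K d k) :=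
  Module.Finite.of_surjective (LinearMap.proj k : (∀ k, Space K d k) →ₗ[K] Space K d k)
    fun x => ⟨Pi.single k x, by simp⟩

/-- The space at an existing vertex. -/
def spaceEquiv {k : ℕ} (h : k < n) : Space K d k ≃ₗ[K] (Fin (d (vtx o k h)) → K) where
  toFun x := x ⟨h⟩
  invFun y := fun _ => y
  map_add' _ _ := rfl
  map_smul' _ _ := rfl
  left_inv _ := rfl
  right_inv _ := rfl

/-- Generic representations are rigid. -/
theorem Rep.isRigid_of_isGeneric {V : Rep K d} (hV : V.toZigzag.IsGeneric (IsUp o) n) :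
    V.IsRigid := by
  rw [Rep.isRigid_iff]
  intro g
  obtain rfl | hn := Nat.eq_zero_or_pos n
  · exact ⟨0, funext fun i => (Nat.not_lt_zero _ i.pos_lt).elim⟩
  let gu : ∀ e, Space K d e →ₗ[K] Space K d (e + 1) := fun e =>
    { toFun := fun x h => if he : IsUp o e then
        g _ _ (upArrow h.down he) (x ⟨e.lt_succ_self.trans h.down⟩) else 0
      map_add' := fun x y => by funext h; split_ifs <;> simp_all
      map_smul' := fun t x => by funext h; split_ifs <;> simp_all }
  let gd : ∀ e, Space K d (e + 1) →ₗ[K] Space K d e := fun e =>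
    { toFun := fun x h => if he : e + 1 < n ∧ ¬ IsUp o e then
        g _ _ (dnArrow he.1 he.2) (x ⟨he.1⟩) else 0
      map_add' := fun x y => by funext h; split_ifs <;> simp_all
      map_smul' := fun t x => by funext h; split_ifs <;> simp_all }
  obtain ⟨z, hz⟩ := hV.exists_solution gu gd (n - 1) (by omega)
  obtain ⟨f, -, hf⟩ := hz 0 fun a _ v _ => (V.toZigzag.flag _ a _).zero_mem
  refine ⟨fun v => (spaceEquiv v.pos_lt).toLinearMap ∘ₗ f v.pos ∘ₗ
    (spaceEquiv (K := K) (d := d) v.pos_lt).symm.toLinearMap, ?_⟩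
  funext i j a
  induction i, j, a using arrow_induction with
  | up e h he =>
    refine LinearMap.ext fun y => ?_
    have h1 := congrFun (LinearMap.congr_fun ((hf e (by omega)).1 he)
      ((spaceEquiv (e.lt_succ_self.trans h)).symm y)) ⟨h⟩
    have h2 : V.toZigzag.up e ((spaceEquiv (e.lt_succ_self.trans h)).symm y) =
        (spaceEquiv h).symm (V.map (upArrow h he) y) := by
      funext h'
      exact V.toZigzag_up he _ h'
    simp only [gu, LinearMap.sub_apply, LinearMap.comp_apply, Pi.sub_apply, h2, V.toZigzag_up he,
      LinearMap.coe_mk, AddHom.coe_mk, dif_pos he] at h1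
    exact h1
  | dn e h he =>
    refine LinearMap.ext fun y => ?_
    have h1 := congrFun (LinearMap.congr_fun ((hf e (by omega)).2 he)
      ((spaceEquiv h).symm y)) ⟨e.lt_succ_self.trans h⟩
    have h2 : V.toZigzag.dn e ((spaceEquiv h).symm y) =
        (spaceEquiv (e.lt_succ_self.trans h)).symm (V.map (dnArrow h he) y) := by
      funext h'
      exact V.toZigzag_dn he h _ h'
    simp only [gd, LinearMap.sub_apply, LinearMap.comp_apply, Pi.sub_apply, h2,
      V.toZigzag_dn he h, LinearMap.coe_mk, AddHom.coe_mk, dif_pos (And.intro h he)] at h1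
    exact h1

end ToZigzag

/-! ### The standard rigid representation -/

section Aligned

variable {K : Type*} [Field K] {m p c : ℕ}

variable (K) in
/-- The subspace of `K ^ m` spanned by the first `c` basis vectors. -/
def initial (m c : ℕ) : Submodule K (Fin m → K) where
  carrier := {x | ∀ q : Fin m, c ≤ q.val → x q = 0}
  zero_mem' := fun _ _ => rfl
  add_mem' := fun hx hy q hq => by simp [hx q hq, hy q hq]
  smul_mem' := fun t x hx q hq => by simp [hx q hq]

theorem initial_zero : initial K m 0 = ⊥ := by
  rw [eq_bot_iff]
  exact fun x hx => funext fun q => hx q q.val.zero_le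

theorem initial_of_le (h : m ≤ c) : initial K m c = ⊤ :=
  eq_top_iff.2 fun x _ q hq => by omega

variable (K) in
/-- The map `K ^ m → K ^ p` which sends the `q`-th basis vector to the `q`-th basis vector, if there
is one, and to zero otherwise. -/
def alignStart (m p : ℕ) : (Fin m → K) →ₗ[K] (Fin p → K) where
  toFun x q := if h : q.val < m then x ⟨q, h⟩ else 0
  map_add' x y := by funext q; dsimp only [Pi.add_apply]; split_ifs <;> simp
  map_smul' t x := by funext q; dsimp only [Pi.smul_apply]; split_ifs <;> simp

variable (K) in
/-- The map `K ^ m → K ^ p` which sends the `q`-th basis vector to the `q`-th basis vector, if there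
is one, and to zero otherwise, where the basis vectors are counted from the end. -/
def alignEnd (m p : ℕ) : (Fin m → K) →ₗ[K] (Fin p → K) where
  toFun x q := if h : p ≤ q.val + m then x ⟨q.val + m - p, by omega⟩ else 0
  map_add' x y := by funext q; dsimp only [Pi.add_apply]; split_ifs <;> simp
  map_smul' t x := by funext q; dsimp only [Pi.smul_apply]; split_ifs <;> simp

theorem alignStart_apply (x : Fin m → K) (q : Fin p) :
    alignStart K m p x q = if h : q.val < m then x ⟨q, h⟩ else 0 := rfl

theorem alignEnd_apply (x : Fin m → K) (q : Fin p) :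
    alignEnd K m p x q = if h : p ≤ q.val + m then x ⟨q.val + m - p, by omega⟩ else 0 := rfl

theorem map_alignStart_initial :
    (initial K m c).map (alignStart K m p) = initial K p (min c m) := by
  ext y
  constructor
  · rintro ⟨x, hx, rfl⟩ q hq
    rw [alignStart_apply]
    split_ifs with h
    · exact hx _ (by simp only; omega)
    · rfl
  · intro hy
    refine ⟨alignStart K p m y, fun q hq => ?_, ?_⟩
    · rw [alignStart_apply]
      split_ifs with h
      · exact hy _ (by simp only; omega)
      · rfl
    · funext q
      rw [alignStart_apply]
      split_ifs with h
      · simp [alignStart_apply]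
      · exact (hy q (by omega)).symm

theorem disjoint_initial_ker_alignStart (h : c ≤ p) :
    Disjoint (initial K m c) (LinearMap.ker (alignStart K m p)) := by
  rw [Submodule.disjoint_def]
  intro x hx hx'
  funext q
  by_cases hq : q.val < p
  · have := congrFun (LinearMap.mem_ker.1 hx') ⟨q, hq⟩
    rw [alignStart_apply] at this
    simpa using this
  · exact hx q (by omega)

theorem comap_alignEnd_initial :
    (initial K p c).comap (alignEnd K m p) = initial K m (c + m - p) := by
  ext x
  constructor
  · intro hx q hq
    have h1 := hx ⟨q.val + p - m, by omega⟩ (by simp only; omega)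
    rw [alignEnd_apply, dif_pos (by simp only; omega)] at h1
    rw [← h1]
    congr 1
    ext
    simp only
    omega
  · intro hx q hq
    rw [alignEnd_apply]
    split_ifs with h
    · exact hx _ (by simp only; omega)
    · rfl

theorem ker_alignEnd : LinearMap.ker (alignEnd K m p) = initial K m (m - p) := by
  rw [← Submodule.comap_bot, ← initial_zero, comap_alignEnd_initial, zero_add]

theorem alignEnd_alignEnd (y : Fin p → K) (q : Fin p) (h : p ≤ q.val + m) :
    alignEnd K m p (alignEnd K p m y) q = y q := by
  rw [alignEnd_apply, dif_pos h, alignEnd_apply, dif_pos (by simp only; omega)]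
  congr 1
  ext
  simp only
  omega

theorem range_alignEnd (h : p ≤ m) : LinearMap.range (alignEnd K m p) = ⊤ :=
  LinearMap.range_eq_top.2 fun y =>
    ⟨alignEnd K p m y, funext fun q => alignEnd_alignEnd y q (by omega)⟩

theorem disjoint_initial_range_alignEnd (h : c + m ≤ p) :
    Disjoint (initial K p c) (LinearMap.range (alignEnd K m p)) := by
  rw [Submodule.disjoint_def]
  rintro _ hx ⟨x, rfl⟩
  funext q
  by_cases hq : c ≤ q.val
  · exact hx q hq
  · rw [alignEnd_apply, dif_neg (by omega), Pi.zero_apply]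

theorem codisjoint_initial_range_alignEnd (h : p ≤ c + m) :
    Codisjoint (initial K p c) (LinearMap.range (alignEnd K m p)) := by
  rw [codisjoint_iff, eq_top_iff]
  intro y _
  have h1 : y - alignEnd K m p (alignEnd K p m y) ∈ initial K p c := fun q hq => by
    rw [Pi.sub_apply, alignEnd_alignEnd y q (by omega), sub_self]
  have := Submodule.add_mem_sup h1 (LinearMap.mem_range_self (alignEnd K m p) (alignEnd K p m y))
  rwa [sub_add_cancel] at this

end Aligned

section Standard

variable {K : Type*} [Field K] {n : ℕ} {o : Fin (n - 1) → Bool} {d : Vertex n o → ℕ}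

variable (K d) in
/-- The representation whose maps align the standard bases at the start for the arrows which point
to the right, and at the end for those which point to the left. -/
def Rep.standard : Rep K d where
  map {i j} _ := if i.pos < j.pos then alignStart K (d i) (d j) else alignEnd K (d i) (d j)

theorem standard_up {e : ℕ} (h : e + 1 < n) (he : IsUp o e) (x : Space K d e) :
    spaceEquiv h ((Rep.standard K d).toZigzag.up e x) =
      alignStart K _ _ (spaceEquiv (e.lt_succ_self.trans h) x) := by
  have h1 : (Rep.standard K d).map (upArrow h he) = alignStart K _ _ := by
    simp [Rep.standard]
  change (Rep.standard K d).toZigzag.up e x ⟨h⟩ = _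
  rw [Rep.toZigzag_up _ he, h1]
  rfl

theorem standard_dn {e : ℕ} (h : e + 1 < n) (he : ¬ IsUp o e) (x : Space K d (e + 1)) :
    spaceEquiv (e.lt_succ_self.trans h) ((Rep.standard K d).toZigzag.dn e x) =
      alignEnd K _ _ (spaceEquiv h x) := by
  have h1 : (Rep.standard K d).map (dnArrow h he) = alignEnd K _ _ := by
    simp [Rep.standard]
  change (Rep.standard K d).toZigzag.dn e x ⟨e.lt_succ_self.trans h⟩ = _
  rw [Rep.toZigzag_dn _ he h, h1]
  rfl

section Transport

variable {M M' N N' : Type*} [AddCommGroup M] [Module K M] [AddCommGroup M'] [Module K M']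
  [AddCommGroup N] [Module K N] [AddCommGroup N'] [Module K N'] (u : M ≃ₗ[K] N) (u' : M' ≃ₗ[K] N')
  {ψ : M →ₗ[K] M'} {φ : N →ₗ[K] N'}

theorem map_comap_of_comm (h : ∀ x, u' (ψ x) = φ (u x)) (I : Submodule K N) :
    (I.comap u.toLinearMap).map ψ = (I.map φ).comap u'.toLinearMap := by
  ext y
  constructor
  · rintro ⟨x, hx, rfl⟩
    exact ⟨u x, hx, (h x).symm⟩
  · rintro ⟨x, hx, hxy⟩
    refine ⟨u.symm x, by simpa using hx, u'.injective ?_⟩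
    rw [h, LinearEquiv.apply_symm_apply, hxy]
    rfl

theorem comap_comap_of_comm (h : ∀ x, u' (ψ x) = φ (u x)) (I : Submodule K N') :
    (I.comap u'.toLinearMap).comap ψ = (I.comap φ).comap u.toLinearMap := by
  ext x
  simp [h]

theorem ker_of_comm (h : ∀ x, u' (ψ x) = φ (u x)) :
    LinearMap.ker ψ = (LinearMap.ker φ).comap u.toLinearMap := by
  ext x
  simp [← h]

theorem range_of_comm (h : ∀ x, u' (ψ x) = φ (u x)) :
    LinearMap.range ψ = (LinearMap.range φ).comap u'.toLinearMap := by
  rw [← Submodule.map_top, ← Submodule.map_top, ← map_comap_of_comm u u' h, Submodule.comap_top]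

theorem disjoint_comap {I J : Submodule K N} (h : Disjoint I J) :
    Disjoint (I.comap u.toLinearMap) (J.comap u.toLinearMap) := by
  rw [disjoint_iff, ← Submodule.comap_inf, h.eq_bot, Submodule.comap_bot]
  exact u.ker

theorem codisjoint_comap {I J : Submodule K N} (h : Codisjoint I J) :
    Codisjoint (I.comap u.toLinearMap) (J.comap u.toLinearMap) := by
  have := (Submodule.orderIsoMapComap u).symm.map_sup I J
  rw [h.eq_top, map_top] at this
  rw [codisjoint_iff]
  exact this.symm

end Transport

/-- All members of the flags of the standard representation are coordinate subspaces. -/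
theorem standard_flag (k : ℕ) (hk : k < n) : ∀ {a : ℕ}, a ≤ k → ∃ c ≤ d (vtx o k hk),
    (Rep.standard K d).toZigzag.flag (IsUp o) a k =
      (initial K (d (vtx o k hk)) c).comap (spaceEquiv hk).toLinearMap := by
  have htrim : ∀ m c : ℕ, ∃ c' ≤ m, initial K m c = initial K m c' := fun m c => by
    obtain h | h := le_total c m
    · exact ⟨c, h, rfl⟩
    · exact ⟨m, le_rfl, by rw [initial_of_le h, initial_of_le le_rfl]⟩
  induction k with
  | zero =>
    intro a _
    exact ⟨_, le_rfl, by rw [initial_of_le le_rfl, Submodule.comap_top]; rfl⟩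
  | succ k ih =>
    intro a ha
    obtain rfl | ha := Nat.eq_or_lt_of_le ha
    · by_cases hb : IsUp o k
      · exact ⟨_, le_rfl, by
          rw [Zigzag.flag_self_of_up hb, initial_of_le le_rfl, Submodule.comap_top]⟩
      · obtain ⟨c', hc', h⟩ := htrim (d (vtx o (k + 1) hk)) _
        refine ⟨c', hc', ?_⟩
        rw [Zigzag.flag_self_of_dn hb, ker_of_comm _ _ (standard_dn hk hb), ker_alignEnd, h]
    · replace ha := Nat.le_of_lt_succ ha
      obtain ⟨c, hc, h⟩ := ih (k.lt_succ_self.trans hk) ha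
      by_cases hb : IsUp o k
      · obtain ⟨c', hc', h'⟩ := htrim (d (vtx o (k + 1) hk)) _
        refine ⟨c', hc', ?_⟩
        rw [Zigzag.flag_succ_of_up hb ha, h, map_comap_of_comm _ _ (standard_up hk hb),
          map_alignStart_initial, h']
      · obtain ⟨c', hc', h'⟩ := htrim (d (vtx o (k + 1) hk)) _
        refine ⟨c', hc', ?_⟩
        rw [Zigzag.flag_succ_of_dn hb ha, h, comap_comap_of_comm _ _ (standard_dn hk hb),
          comap_alignEnd_initial, h']

theorem standard_isGeneric : (Rep.standard K d).toZigzag.IsGeneric (IsUp o) n := by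
  intro k hk
  refine ⟨fun hb a ha => ?_, fun hb => ⟨?_, fun a ha => ?_⟩⟩
  · obtain ⟨c, hc, h⟩ := standard_flag (K := K) (d := d) k (k.lt_succ_self.trans hk) ha
    rw [h, ker_of_comm _ _ (standard_up hk hb), map_comap_of_comm _ _ (standard_up hk hb)]
    obtain h' | h' := le_total c (d (vtx o (k + 1) hk))
    · exact Or.inl (disjoint_comap _ (disjoint_initial_ker_alignStart h'))
    · right
      rw [map_alignStart_initial, min_eq_left hc, initial_of_le h', Submodule.comap_top]
  · rw [ker_of_comm _ _ (standard_dn hk hb), range_of_comm _ _ (standard_dn hk hb)]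
    obtain h | h := le_total (d (vtx o (k + 1) hk)) (d (vtx o k (k.lt_succ_self.trans hk)))
    · left
      rw [ker_alignEnd, Nat.sub_eq_zero_of_le h, initial_zero, Submodule.comap_bot]
      exact (spaceEquiv hk).ker
    · right
      rw [range_alignEnd h, Submodule.comap_top]
  · obtain ⟨c, hc, h⟩ := standard_flag (K := K) (d := d) k (k.lt_succ_self.trans hk) ha
    rw [h, range_of_comm _ _ (standard_dn hk hb)]
    obtain h' | h' := le_total (c + d (vtx o (k + 1) hk)) (d (vtx o k (k.lt_succ_self.trans hk)))
    · exact Or.inl (disjoint_comap _ (disjoint_initial_range_alignEnd h'))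
    · exact Or.inr (codisjoint_comap _ (codisjoint_initial_range_alignEnd h'))

end Standard

/-! ### Interval representations -/

theorem Zigzag.mem_closedFamily_iff {K : Type*} [Field K] {E : ℕ → Type*}
    [∀ k, AddCommGroup (E k)] [∀ k, Module K (E k)] {Z : Zigzag K E} {b : ℕ → Prop} {c : ℕ → K}
    {a k : ℕ} {x : ∀ l, E l} : x ∈ Z.closedFamily b c a k ↔
      (∀ l, l < a ∨ k < l → x l = 0) ∧ ∀ e,
        (b e → a ≤ e → e ≤ k → Z.up e (x e) = c e • x (e + 1)) ∧
        (¬ b e → a ≤ e + 1 → e + 1 ≤ k → Z.dn e (x (e + 1)) = c e • x e) := by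
  constructor
  · rintro ⟨⟨h1, h2⟩, h3⟩
    refine ⟨h1, fun e => ⟨fun hb ha he => ?_, fun hb ha he => (h2 e he).2 hb ha⟩⟩
    obtain rfl | he := Nat.eq_or_lt_of_le he
    · rw [if_pos hb] at h3
      rw [h1 (e + 1) (Or.inr e.lt_succ_self), smul_zero]
      exact h3
    · exact (h2 e he).1 hb ha
  · rintro ⟨h1, h2⟩
    refine ⟨⟨h1, fun e he => ⟨fun hb ha => (h2 e).1 hb ha he.le,
      fun hb ha => (h2 e).2 hb ha he⟩⟩, ?_⟩
    split_ifs with hb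
    · by_cases ha : a ≤ k
      · have := (h2 k).1 hb ha le_rfl
        rw [h1 (k + 1) (Or.inr k.lt_succ_self), smul_zero] at this
        exact this
      · rw [SetLike.mem_coe, LinearMap.mem_ker, LinearMap.comp_apply, LinearMap.proj_apply,
          h1 k (Or.inl (not_le.1 ha)), map_zero]
    · trivial

section Interval

variable {K : Type*} [Field K] {n : ℕ} {o : Fin (n - 1) → Bool} {d : Vertex n o → ℕ}

variable (K o) in
/-- The scalar by which the interval representations act along the edge `e`. It is `-1` if `e` is
the edge to the right of an inner sink, and `1` otherwise. With this choice the two conditions at an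
inner sink add up to the block row of `blockMatrix`, in which both blocks have a positive sign. -/
def edgeSign (e : ℕ) : K := if ¬ IsUp o e ∧ 0 < e ∧ IsUp o (e - 1) then -1 else 1

theorem edgeSign_ne_zero (e : ℕ) : edgeSign K o e ≠ 0 := by
  unfold edgeSign
  split_ifs <;> simp

theorem edgeSign_mul_self (e : ℕ) : edgeSign K o e * edgeSign K o e = 1 := by
  unfold edgeSign
  split_ifs <;> simp

theorem edgeSign_of_isUp {e : ℕ} (he : IsUp o e) : edgeSign K o e = 1 :=
  if_neg fun h => h.1 he

theorem edgeSign_succ_of_not_isUp {e : ℕ} (he : ¬ IsUp o e) : edgeSign K o (e + 1) = 1 :=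
  if_neg fun h => he h.2.2

theorem edgeSign_sink {e : ℕ} (he : IsUp o e) (he' : ¬ IsUp o (e + 1)) :
    edgeSign K o (e + 1) = -1 :=
  if_pos ⟨he', e.succ_pos, he⟩

variable (K) in
/-- The representation of dimension vector `α_{ij}` which is nonzero on all arrows between `i` and
`j`. It is isomorphic to the indecomposable one, in which all these scalars are `1`. -/
def Rep.interval (i j : Vertex n o) : Rep K (root i j) where
  map a := edgeSign K o a.1.val •
    { toFun := fun x _ => ∑ q, x q
      map_add' := fun x y => by funext; simp [Finset.sum_add_distrib]
      map_smul' := fun t x => by funext; simp [Finset.mul_sum] }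

theorem root_eq_one {i j v : Vertex n o} (h : i.pos ≤ v.pos ∧ v.pos ≤ j.pos) : root i j v = 1 :=
  if_pos h

theorem root_eq_zero {i j v : Vertex n o} (h : ¬ (i.pos ≤ v.pos ∧ v.pos ≤ j.pos)) :
    root i j v = 0 :=
  if_neg h

theorem root_le_one {i j v : Vertex n o} : root i j v ≤ 1 := by
  unfold root
  split_ifs <;> simp

theorem eq_sum_smul_one {m : ℕ} (hm : m ≤ 1) (y : Fin m → K) :
    y = (∑ q, y q) • (fun _ => (1 : K)) := by
  have : Subsingleton (Fin m) := ⟨fun p q => by ext; omega⟩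
  funext p
  rw [Fintype.sum_subsingleton y p]
  simp

theorem interval_map {i j v w : Vertex n o} (a : v ⟶ w) (y : Fin (root i j v) → K) :
    (Rep.interval K i j).map a y =
      (edgeSign K o a.1.val * ∑ q, y q) • (fun _ => (1 : K)) := by
  funext q
  simp [Rep.interval]

theorem interval_eq_zero {i j v : Vertex n o} (h : ¬ (i.pos ≤ v.pos ∧ v.pos ≤ j.pos))
    (y : Fin (root i j v) → K) : y = 0 := by
  have := root_eq_zero h
  funext q
  exact (Nat.not_lt_zero q.val (this ▸ q.isLt)).elim

theorem interval_sum_one {i j v : Vertex n o} (h : i.pos ≤ v.pos ∧ v.pos ≤ j.pos) :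
    ∑ _q : Fin (root i j v), (1 : K) = 1 := by
  simp [root_eq_one h]

/-- The component of a family at a vertex. -/
def component (x : ∀ l, Space K d l) (v : Vertex n o) : Fin (d v) → K := x v.pos ⟨v.pos_lt⟩

/-- The linear map which sends the basis vector of `K ^ m`, for `m = 1`, to `w`. -/
def lineMap (m : ℕ) {p : ℕ} (w : Fin p → K) : (Fin m → K) →ₗ[K] (Fin p → K) where
  toFun y := (∑ q, y q) • w
  map_add' y z := by simp [Finset.sum_add_distrib, add_smul]
  map_smul' t y := by simp [← Finset.mul_sum, mul_smul]

theorem lineMap_apply {m p : ℕ} (w : Fin p → K) (y : Fin m → K) :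
    lineMap m w y = (∑ q, y q) • w := rfl

/-- The homomorphisms from an interval representation are the compatible families on this
interval: such a homomorphism is determined by the images of the basis vectors. -/
def homIntervalEquiv (i j : Vertex n o) (V : Rep K d) :
    (Rep.interval K i j).Hom V ≃ₗ[K]
      V.toZigzag.closedFamily (IsUp o) (edgeSign K o) i.pos j.pos where
  toFun f := ⟨fun k h => f.1 (vtx o k h.down) (fun _ => 1), by
    obtain ⟨f, hf⟩ := f
    rw [Rep.mem_hom] at hf
    rw [Zigzag.mem_closedFamily_iff]
    refine ⟨fun l hl => ?_, fun e => ⟨fun he h1 h2 => ?_, fun he h1 h2 => ?_⟩⟩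
    · funext h
      dsimp only
      rw [interval_eq_zero (v := vtx o l h.down) (by rw [pos_vtx]; omega) (fun _ => 1), map_zero]
      rfl
    · funext h
      have h3 := LinearMap.congr_fun (hf _ _ (upArrow h.down he)) (fun _ => 1)
      rw [LinearMap.comp_apply, LinearMap.comp_apply, interval_map,
        interval_sum_one (v := vtx o e (e.lt_succ_self.trans h.down)) ⟨h1, h2⟩, mul_one,
        map_smul] at h3
      rw [Rep.toZigzag_up _ he]
      exact h3.symm
    · funext h
      have hn : e + 1 < n := h2.trans_lt j.pos_lt
      have h3 := LinearMap.congr_fun (hf _ _ (dnArrow hn he)) (fun _ => 1)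
      rw [LinearMap.comp_apply, LinearMap.comp_apply, interval_map,
        interval_sum_one (v := vtx o (e + 1) hn) ⟨h1, h2⟩, mul_one, map_smul] at h3
      rw [Rep.toZigzag_dn _ he hn]
      exact h3.symm⟩
  map_add' _ _ := rfl
  map_smul' _ _ := rfl
  invFun x := ⟨fun v => lineMap (root i j v) (component x.1 v), by
    obtain ⟨x, hx⟩ := x
    rw [Zigzag.mem_closedFamily_iff] at hx
    obtain ⟨h0, hx⟩ := hx
    have hone : ∀ v : Vertex n o, lineMap (root i j v) (component x v) (fun _ => 1) =
        component x v := fun v => by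
      rw [lineMap_apply]
      by_cases hv : i.pos ≤ v.pos ∧ v.pos ≤ j.pos
      · rw [interval_sum_one hv, one_smul]
      · have h1 : component x v = 0 := congrFun (h0 v.pos (by omega)) _
        rw [h1, smul_zero]
    rw [Rep.mem_hom]
    refine arrow_induction (fun e h he => ?_) (fun e h he => ?_)
    · refine LinearMap.ext fun y => ?_
      rw [LinearMap.comp_apply, LinearMap.comp_apply, interval_map, map_smul, hone,
        lineMap_apply, map_smul]
      by_cases hv : i.pos ≤ e ∧ e ≤ j.pos
      · have h3 : V.map (upArrow h he) (component x (vtx o e (e.lt_succ_self.trans h))) =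
            edgeSign K o e • component x (vtx o (e + 1) h) :=
          (V.toZigzag_up he _ ⟨h⟩).symm.trans (congrFun ((hx e).1 he hv.1 hv.2) ⟨h⟩)
        rw [h3, smul_smul, mul_comm]
        rfl
      · rw [interval_eq_zero (v := vtx o e (e.lt_succ_self.trans h)) hv y]
        simp
    · refine LinearMap.ext fun y => ?_
      rw [LinearMap.comp_apply, LinearMap.comp_apply, interval_map, map_smul, hone,
        lineMap_apply, map_smul]
      by_cases hv : i.pos ≤ e + 1 ∧ e + 1 ≤ j.pos
      · have h3 : V.map (dnArrow h he) (component x (vtx o (e + 1) h)) =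
            edgeSign K o e • component x (vtx o e (e.lt_succ_self.trans h)) :=
          (V.toZigzag_dn he h _ ⟨e.lt_succ_self.trans h⟩).symm.trans
            (congrFun ((hx e).2 he hv.1 hv.2) ⟨e.lt_succ_self.trans h⟩)
        rw [h3, smul_smul, mul_comm]
        rfl
      · rw [interval_eq_zero (v := vtx o (e + 1) h) hv y]
        simp⟩
  left_inv f := by
    refine Subtype.ext (funext fun v => LinearMap.ext fun y => ?_)
    change (∑ q, y q) • f.1 v (fun _ => 1) = f.1 v y
    rw [← map_smul, ← eq_sum_smul_one root_le_one]
  right_inv x := by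
    refine Subtype.ext (funext fun k => funext fun h => ?_)
    change (∑ _q : Fin (root i j (vtx o k h.down)), (1 : K)) • x.1 k h = x.1 k h
    by_cases hv : i.pos ≤ k ∧ k ≤ j.pos
    · rw [interval_sum_one (v := vtx o k h.down) hv, one_smul]
    · rw [(Zigzag.mem_closedFamily_iff.1 x.2).1 k (by omega), Pi.zero_apply, smul_zero]

theorem interval_isRigid (i j : Vertex n o) : (Rep.interval K i j).IsRigid := by
  rw [Rep.isRigid_iff]
  intro g
  -- Multiplying the component at each vertex `k` by `φ k` changes the arrow between `e` and `e + 1`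
  -- by a multiple of `φ (e + 1) - φ e`.
  let δ : ℕ → K := fun e => if h : e + 1 < n then
    if he : IsUp o e then (edgeSign K o e)⁻¹ * ∑ q, g _ _ (upArrow h he) (fun _ => 1) q
    else -((edgeSign K o e)⁻¹ * ∑ q, g _ _ (dnArrow h he) (fun _ => 1) q) else 0
  let φ : ℕ → K := fun k => ∑ e ∈ Finset.range k, δ e
  have hφ : ∀ e, φ (e + 1) = φ e + δ e := fun e => Finset.sum_range_succ _ _
  refine ⟨fun v => φ v.pos • LinearMap.id, ?_⟩
  have key : ∀ {v w : Vertex n o} (a : v ⟶ w),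
      (φ w.pos - φ v.pos) * edgeSign K o a.1.val = ∑ q, g _ _ a (fun _ => 1) q →
      (Rep.interval K i j).diff (Rep.interval K i j) (fun v => φ v.pos • LinearMap.id) v w a =
        g v w a := by
    intro v w a h
    refine LinearMap.ext fun y => ?_
    have h1 : (Rep.interval K i j).diff (Rep.interval K i j) (fun v => φ v.pos • LinearMap.id) v w a
        y = (φ w.pos - φ v.pos) • (Rep.interval K i j).map a y := by
      simp [Rep.diff, sub_smul]
    have h2 : g v w a y = (∑ q, y q) • g v w a (fun _ => 1) := by
      rw [← map_smul, ← eq_sum_smul_one root_le_one]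
    rw [h1, h2, interval_map, smul_smul, ← mul_assoc, h,
      eq_sum_smul_one root_le_one (g v w a fun _ => 1), smul_smul, mul_comm]
    congr 2
    simp only [Pi.smul_apply, smul_eq_mul, mul_one]
    have hw := eq_sum_smul_one root_le_one (g v w a fun _ => 1)
    exact Finset.sum_congr rfl fun q _ => by
      have := congrFun hw q
      simpa using this.symm
  funext v w a
  refine key a ?_
  induction v, w, a using arrow_induction with
  | up e h he =>
    simp only [pos_vtx, hφ, add_sub_cancel_left]
    simp only [δ, dif_pos h, dif_pos he]
    change _ * edgeSign K o e = _
    rw [mul_comm, ← mul_assoc, mul_inv_cancel₀ (edgeSign_ne_zero e), one_mul]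
  | dn e h he =>
    simp only [pos_vtx, hφ, sub_add_cancel_left]
    simp only [δ, dif_pos h, dif_neg he, neg_neg]
    change _ * edgeSign K o e = _
    rw [mul_comm, ← mul_assoc, mul_inv_cancel₀ (edgeSign_ne_zero e), one_mul]

end Interval

/-! ### Transport from the sources -/

section Transport

variable {K : Type*} [Field K] {n : ℕ} {o : Fin (n - 1) → Bool}
  {E : ℕ → Type*} [∀ k, AddCommGroup (E k)] [∀ k, Module K (E k)]

variable (o) in
/-- `k` is a source of the interval `I, …, J`. -/
def IsSrc (I J k : ℕ) : Prop :=
  I ≤ k ∧ k ≤ J ∧ (k = I ∨ ¬ IsUp o (k - 1)) ∧ (k = J ∨ IsUp o k)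

variable (o) in
/-- `k` is a sink of the interval `I - 1, …, J + 1` which is different from `I` and `J`. -/
def IsSnk (I J k : ℕ) : Prop :=
  I ≤ k + 1 ∧ k ≤ J + 1 ∧ k ≠ I ∧ k ≠ J ∧ (k ≤ J → ¬ IsUp o k) ∧ (I ≤ k → IsUp o (k - 1))

variable (o) in
/-- The vectors `L k` (resp. `R k`) arise from the vectors `X l` at the sources `l` of the interval
`I, …, J` by transport to the right (resp. to the left) along the longest path which ends in `k`. -/
structure IsTransport (Z : Zigzag K E) (I J : ℕ) (X L R : ∀ k, E k) : Prop where
  left_start : ∀ k, I ≤ k → (k = I ∨ ¬ IsUp o (k - 1)) → L k = X k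
  left_step : ∀ e, IsUp o e → I ≤ e → L (e + 1) = Z.up e (L e)
  left_zero : ∀ k, k < I → L k = 0
  right_start : ∀ k, k ≤ J → (k = J ∨ IsUp o k) → R k = X k
  right_step : ∀ e, ¬ IsUp o e → e + 1 ≤ J → R e = Z.dn e (R (e + 1))
  right_zero : ∀ k, J < k → R k = 0

variable {Z : Zigzag K E} {I J : ℕ} {X L R y : ∀ k, E k}

theorem IsTransport.left_eq (h : IsTransport o Z I J X L R)
    (hy : y ∈ Z.closedFamily (IsUp o) (edgeSign K o) I J) (hX : ∀ k, IsSrc o I J k → X k = y k)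
    (k : ℕ) : k ≤ J → IsSrc o I J k ∨ I < k ∧ IsUp o (k - 1) → L k = y k := by
  obtain ⟨-, hy⟩ := Zigzag.mem_closedFamily_iff.1 hy
  have hsrc : ∀ k, IsSrc o I J k → L k = y k := fun k hk => by
    rw [h.left_start k hk.1 hk.2.2.1, hX k hk]
  induction k with
  | zero => exact fun _ hk => hsrc 0 (hk.resolve_right (by omega))
  | succ k ih =>
    rintro hkJ (hk | ⟨hk, hup⟩)
    · exact hsrc _ hk
    · rw [Nat.add_sub_cancel] at hup
      have h1 : L k = y k := ih (by omega) (by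
        by_cases hk' : I < k ∧ IsUp o (k - 1)
        · exact Or.inr hk'
        · refine Or.inl ⟨by omega, by omega, ?_, Or.inr hup⟩
          by_cases hkI : k = I
          · exact Or.inl hkI
          · exact Or.inr fun h => hk' ⟨by omega, h⟩)
      rw [h.left_step k hup (by omega), h1, (hy k).1 hup (by omega) (by omega),
        edgeSign_of_isUp hup, one_smul]

theorem IsTransport.right_eq (h : IsTransport o Z I J X L R)
    (hy : y ∈ Z.closedFamily (IsUp o) (edgeSign K o) I J) (hX : ∀ k, IsSrc o I J k → X k = y k)
    (m : ℕ) : ∀ k, k + m = J → I ≤ k → (IsSrc o I J k → R k = y k) ∧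
      (k < J → ¬ IsUp o k → R k = edgeSign K o k • y k) := by
  obtain ⟨-, hy⟩ := Zigzag.mem_closedFamily_iff.1 hy
  have hsrc : ∀ k, IsSrc o I J k → R k = y k := fun k hk => by
    rw [h.right_start k hk.2.1 hk.2.2.2, hX k hk]
  induction m with
  | zero => exact fun k hk _ => ⟨hsrc k, fun hk' => by omega⟩
  | succ m ih =>
    intro k hk hkI
    refine ⟨hsrc k, fun hkJ hdn => ?_⟩
    have h1 : R (k + 1) = y (k + 1) := by
      by_cases hs : IsSrc o I J (k + 1)
      · exact hsrc _ hs
      · have h2 : k + 1 < J ∧ ¬ IsUp o (k + 1) := by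
          by_contra hc
          refine hs ⟨by omega, by omega, Or.inr hdn, ?_⟩
          by_cases hkJ' : k + 1 = J
          · exact Or.inl hkJ'
          · exact Or.inr (by_contra fun h => hc ⟨by omega, h⟩)
        rw [((ih (k + 1) (by omega) (by omega)).2 h2.1 h2.2), edgeSign_succ_of_not_isUp hdn,
          one_smul]
    rw [h.right_step k hdn (by omega), h1, (hy k).2 hdn (by omega) (by omega)]

/-- At an inner sink the two transports of a compatible family cancel; at an outer one the only
transport vanishes. -/
theorem IsTransport.add_eq_zero (hIJ : I ≤ J) (h : IsTransport o Z I J X L R)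
    (hy : y ∈ Z.closedFamily (IsUp o) (edgeSign K o) I J) (hX : ∀ k, IsSrc o I J k → X k = y k)
    {k : ℕ} (hk : IsSnk o I J k) : L k + R k = 0 := by
  have hy' := Zigzag.mem_closedFamily_iff.1 hy
  obtain ⟨h1, h2, h3, h4, h5, h6⟩ := hk
  obtain hkI | hkI := lt_or_ge k I
  · obtain rfl : I = k + 1 := by omega
    have hdn := h5 (by omega)
    rw [h.left_zero k hkI, zero_add, h.right_step k hdn hIJ]
    have h7 := h.right_eq hy hX (J - (k + 1)) (k + 1) (by omega) le_rfl
    have h8 : Z.dn k (y (k + 1)) = 0 := by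
      rw [(hy'.2 k).2 hdn le_rfl hIJ, hy'.1 k (Or.inl k.lt_succ_self), smul_zero]
    by_cases hs : IsSrc o (k + 1) J (k + 1)
    · rw [h7.1 hs, h8]
    · have h9 : k + 1 ≠ J ∧ ¬ IsUp o (k + 1) := by
        by_contra hc
        exact hs ⟨le_rfl, hIJ, Or.inl rfl, by tauto⟩
      rw [h7.2 (by omega) h9.2, map_smul, h8, smul_zero]
  · have hup := h6 hkI
    obtain ⟨e, rfl⟩ : ∃ e, k = e + 1 := ⟨k - 1, by omega⟩
    rw [Nat.add_sub_cancel] at hup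
    obtain hkJ | hkJ := lt_or_ge J (e + 1)
    · obtain rfl : J = e := by omega
      have h7 : L J = y J := h.left_eq hy hX J le_rfl (by
        by_cases hs : I < J ∧ IsUp o (J - 1)
        · exact Or.inr hs
        · refine Or.inl ⟨hIJ, le_rfl, ?_, Or.inl rfl⟩
          by_cases hJI : J = I
          · exact Or.inl hJI
          · exact Or.inr fun h => hs ⟨by omega, h⟩)
      rw [h.right_zero _ hkJ, add_zero, h.left_step J hup hIJ, h7, (hy'.2 J).1 hup hIJ le_rfl,
        hy'.1 _ (Or.inr hkJ), smul_zero]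
    · have hdn := h5 hkJ
      rw [h.left_eq hy hX (e + 1) hkJ (Or.inr ⟨by omega, hup⟩),
        (h.right_eq hy hX (J - (e + 1)) (e + 1) (by omega) hkI).2 (by omega) hdn,
        edgeSign_sink hup hdn, neg_smul, one_smul, add_neg_cancel]

/-- A compatible family is determined by its components at the sources. -/
theorem IsTransport.eq_zero (h : IsTransport o Z I J X 0 0)
    (hy : y ∈ Z.closedFamily (IsUp o) (edgeSign K o) I J) (hX : ∀ k, IsSrc o I J k → X k = y k) :
    y = 0 := by
  funext k
  by_cases hk : k < I ∨ J < k
  · exact (Zigzag.mem_closedFamily_iff.1 hy).1 k hk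
  by_cases hL : IsSrc o I J k ∨ I < k ∧ IsUp o (k - 1)
  · exact (h.left_eq hy hX k (by omega) hL).symm
  · have h1 : k < J ∧ ¬ IsUp o k := by
      by_contra hc
      have h2 : k = J ∨ IsUp o k := by
        by_cases hkJ : k = J
        · exact Or.inl hkJ
        · exact Or.inr (by_contra fun h => hc ⟨by omega, h⟩)
      refine hL (Or.inl ⟨by omega, by omega, ?_, h2⟩)
      by_cases hkI : k = I
      · exact Or.inl hkI
      · exact Or.inr fun h => hL (Or.inr ⟨by omega, h⟩)
    have h2 := (h.right_eq hy hX (J - k) k (by omega) (by omega)).2 h1.1 h1.2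
    exact (smul_eq_zero.1 h2.symm).resolve_left (edgeSign_ne_zero k)

/-- Vectors at the sources whose transports cancel at the sinks extend to a compatible family. -/
theorem IsTransport.exists_family (hIJ : I ≤ J) (h : IsTransport o Z I J X L R)
    (hsnk : ∀ k, IsSnk o I J k → L k + R k = 0) :
    ∃ y ∈ Z.closedFamily (IsUp o) (edgeSign K o) I J, ∀ k, IsSrc o I J k → y k = X k := by
  let y : ∀ k, E k := fun k =>
    if k < I ∨ J < k then 0
    else if I < k ∧ IsUp o (k - 1) then L k
    else if k < J ∧ ¬ IsUp o k then edgeSign K o k • R k else X k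
  have hyout : ∀ k, k < I ∨ J < k → y k = 0 := fun k hk => if_pos hk
  have hyL : ∀ k, I ≤ k → k ≤ J → I < k ∧ IsUp o (k - 1) → y k = L k := fun k h1 h2 h3 => by
    simp only [y]
    rw [if_neg (by omega), if_pos h3]
  have hyR : ∀ k, I ≤ k → k ≤ J → ¬ (I < k ∧ IsUp o (k - 1)) → k < J ∧ ¬ IsUp o k →
      y k = edgeSign K o k • R k := fun k h1 h2 h3 h4 => by
    simp only [y]
    rw [if_neg (by omega), if_neg h3, if_pos h4]
  have hyX : ∀ k, I ≤ k → k ≤ J → ¬ (I < k ∧ IsUp o (k - 1)) → ¬ (k < J ∧ ¬ IsUp o k) →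
      y k = X k := fun k h1 h2 h3 h4 => by
    simp only [y]
    rw [if_neg (by omega), if_neg h3, if_neg h4]
  have hL : ∀ k, I ≤ k → k ≤ J → (k = J ∨ IsUp o k) → y k = L k := fun k h1 h2 h3 => by
    by_cases h4 : I < k ∧ IsUp o (k - 1)
    · exact hyL k h1 h2 h4
    · rw [hyX k h1 h2 h4 (fun h5 => h3.elim (by omega) h5.2), h.left_start k h1]
      by_cases hkI : k = I
      · exact Or.inl hkI
      · exact Or.inr fun h => h4 ⟨by omega, h⟩
  refine ⟨y, Zigzag.mem_closedFamily_iff.2 ⟨hyout, fun e => ⟨fun hup h1 h2 => ?_,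
    fun hdn h1 h2 => ?_⟩⟩, fun k hk => ?_⟩
  · rw [edgeSign_of_isUp hup, one_smul, hL e h1 h2 (Or.inr hup), ← h.left_step e hup h1]
    obtain rfl | h2 := Nat.eq_or_lt_of_le h2
    · rw [hyout _ (Or.inr e.lt_succ_self)]
      by_cases he : IsSnk o I e (e + 1)
      · have := hsnk _ he
        rwa [h.right_zero _ e.lt_succ_self, add_zero] at this
      · exact (he ⟨by omega, le_rfl, by omega, by omega, fun _ => by omega, fun _ => hup⟩).elim
    · rw [hyL (e + 1) (by omega) h2 ⟨by omega, hup⟩]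
  · have h3 : y (e + 1) = R (e + 1) := by
      by_cases h4 : e + 1 < J ∧ ¬ IsUp o (e + 1)
      · rw [hyR _ h1 h2 (fun h => hdn h.2) h4, edgeSign_succ_of_not_isUp hdn, one_smul]
      · rw [hyX _ h1 h2 (fun h => hdn h.2) h4, h.right_start _ h2]
        by_cases hkJ : e + 1 = J
        · exact Or.inl hkJ
        · exact Or.inr (by_contra fun h => h4 ⟨by omega, h⟩)
    rw [h3, ← h.right_step e hdn h2]
    obtain h1 | h1 := lt_or_ge e I
    · have h4 := hsnk e ⟨by omega, by omega, by omega, by omega, fun _ => hdn, fun _ => by omega⟩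
      rw [h.left_zero e h1, zero_add] at h4
      rw [h4, hyout e (Or.inl h1), smul_zero]
    · by_cases h4 : I < e ∧ IsUp o (e - 1)
      · have h5 := hsnk e ⟨by omega, by omega, by omega, by omega, fun _ => hdn, fun _ => h4.2⟩
        obtain ⟨e, rfl⟩ : ∃ e', e = e' + 1 := ⟨e - 1, by omega⟩
        rw [hyL _ h1 (by omega) h4, edgeSign_sink (e := e) h4.2 hdn, neg_smul, one_smul]
        exact (neg_eq_of_add_eq_zero_right h5).symm
      · rw [hyR e h1 (by omega) h4 ⟨by omega, hdn⟩, smul_smul, edgeSign_mul_self, one_smul]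
  · obtain ⟨h1, h2, h3, h4⟩ := hk
    exact hyX k h1 h2 (fun h => h3.elim (by omega) fun h' => h' h.2)
      (fun h => h4.elim (by omega) h.2)

end Transport

/-! ### Paths in a quiver of type A -/

section Paths

variable {n : ℕ} {o : Fin (n - 1) → Bool}

theorem Vertex.ext_pos {v w : Vertex n o} (h : v.pos = w.pos) : v = w := Fin.ext h

theorem arrow_cases {i j : Vertex n o} (a : i ⟶ j) :
    (j.pos = i.pos + 1 ∧ IsUp o i.pos) ∨ (i.pos = j.pos + 1 ∧ ¬ IsUp o j.pos) := by
  induction i, j, a using arrow_induction with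
  | up e h he => exact Or.inl ⟨rfl, he⟩
  | dn e h he => exact Or.inr ⟨rfl, he⟩

instance {i j : Vertex n o} : Subsingleton (i ⟶ j) := by
  refine ⟨fun ⟨e, he⟩ ⟨e', he'⟩ => Subtype.ext (Fin.ext ?_)⟩
  have h1 := arrow_cases (⟨e, he⟩ : i ⟶ j)
  split_ifs at he <;> split_ifs at he' <;> simp only <;> omega

/-- Paths run monotonically. -/
theorem path_cases {l k : Vertex n o} (p : Quiver.Path l k) :
    (l.pos + p.length = k.pos ∧ (∀ e, l.pos ≤ e → e < k.pos → IsUp o e) ∧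
      ∀ v ∈ p.vertices, l.pos ≤ v.pos ∧ v.pos ≤ k.pos) ∨
    (k.pos + p.length = l.pos ∧ (∀ e, k.pos ≤ e → e < l.pos → ¬ IsUp o e) ∧
      ∀ v ∈ p.vertices, k.pos ≤ v.pos ∧ v.pos ≤ l.pos) := by
  induction p with
  | nil =>
    left
    refine ⟨rfl, fun e h1 h2 => by omega, fun v hv => ?_⟩
    rw [Quiver.Path.vertices_nil, List.mem_singleton] at hv
    subst hv
    exact ⟨le_rfl, le_rfl⟩
  | @cons b k p a ih =>
    simp only [Quiver.Path.length_cons, Quiver.Path.mem_vertices_cons]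
    obtain ⟨h1, h2⟩ | ⟨h1, h2⟩ := arrow_cases a
    · obtain ⟨h3, h4, h5⟩ | ⟨h3, h4, h5⟩ := ih
      · refine Or.inl ⟨by omega, fun e he he' => ?_, ?_⟩
        · obtain rfl | he' := Nat.eq_or_lt_of_le (Nat.le_of_lt_succ (h1 ▸ he'))
          · exact h2
          · exact h4 e he he'
        · rintro v (hv | rfl)
          · have := h5 v hv
            omega
          · omega
      · obtain hlen | hlen := Nat.eq_zero_or_pos p.length
        · refine Or.inl ⟨by omega, fun e he he' => ?_, ?_⟩
          · obtain rfl : e = b.pos := by omega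
            exact h2
          · rintro v (hv | rfl)
            · have := h5 v hv
              omega
            · omega
        · exact (h4 b.pos le_rfl (by omega) h2).elim
    · obtain ⟨h3, h4, h5⟩ | ⟨h3, h4, h5⟩ := ih
      · obtain hlen | hlen := Nat.eq_zero_or_pos p.length
        · refine Or.inr ⟨by omega, fun e he he' => ?_, ?_⟩
          · obtain rfl : e = k.pos := by omega
            exact h2
          · rintro v (hv | rfl)
            · have := h5 v hv
              omega
            · omega
        · exact (h2 (h4 k.pos (by omega) (by omega))).elim
      · refine Or.inr ⟨by omega, fun e he he' => ?_, ?_⟩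
        · obtain rfl | he := Nat.eq_or_lt_of_le he
          · exact h2
          · exact h4 e (by omega) he'
        · rintro v (hv | rfl)
          · have := h5 v hv
            omega
          · omega

theorem path_right {l k : Vertex n o} (p : Quiver.Path l k) (h : l.pos ≤ k.pos) :
    l.pos + p.length = k.pos ∧ (∀ e, l.pos ≤ e → e < k.pos → IsUp o e) ∧
      ∀ v ∈ p.vertices, l.pos ≤ v.pos ∧ v.pos ≤ k.pos := by
  obtain h1 | ⟨h1, h2, h3⟩ := path_cases p
  · exact h1
  · exact ⟨by omega, fun e _ _ => by omega, fun v hv => by have := h3 v hv; omega⟩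

theorem path_left {l k : Vertex n o} (p : Quiver.Path l k) (h : k.pos ≤ l.pos) :
    k.pos + p.length = l.pos ∧ (∀ e, k.pos ≤ e → e < l.pos → ¬ IsUp o e) ∧
      ∀ v ∈ p.vertices, k.pos ≤ v.pos ∧ v.pos ≤ l.pos := by
  obtain ⟨h1, h2, h3⟩ | h1 := path_cases p
  · exact ⟨by omega, fun e _ _ => by omega, fun v hv => by have := h3 v hv; omega⟩
  · exact h1

instance {l k : Vertex n o} : Subsingleton (Quiver.Path l k) := by
  refine ⟨fun p => ?_⟩
  induction p with
  | nil =>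
    intro q
    exact (q.eq_nil_of_length_zero (by have := (path_right q le_rfl).1; omega)).symm
  | @cons b k p a ih =>
    intro q
    cases q with
    | nil =>
      have := (path_right (p.cons a) le_rfl).1
      rw [Quiver.Path.length_cons] at this
      omega
    | @cons b' _ q a' =>
      have hb : b.pos = b'.pos := by
        by_contra hne
        obtain ⟨h1, h2⟩ | ⟨h1, h2⟩ := arrow_cases a <;>
          obtain ⟨h1', h2'⟩ | ⟨h1', h2'⟩ := arrow_cases a'
        · omega
        · obtain h | h := Nat.lt_or_ge l.pos k.pos
          · exact h2' ((path_right q (by omega)).2.1 _ (by omega) (by omega))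
          · exact (path_left p (by omega)).2.1 _ le_rfl (by omega) h2
        · obtain h | h := Nat.lt_or_ge l.pos k.pos
          · exact h2 ((path_right p (by omega)).2.1 _ (by omega) (by omega))
          · exact (path_left q (by omega)).2.1 _ le_rfl (by omega) h2'
        · omega
      obtain rfl := Vertex.ext_pos hb
      rw [ih q, Subsingleton.elim a a']

/-- A path in `Q(I, k)` which ends in `k` is a longest one if and only if it cannot be extended to
the left. -/
theorem isLongestPathIn_left {l k : Vertex n o} {I : ℕ} (p : Quiver.Path l k) :
    IsLongestPathIn (segment o I k.pos) p ↔
      I ≤ l.pos ∧ l.pos ≤ k.pos ∧ (l.pos = I ∨ ¬ IsUp o (l.pos - 1)) := by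
  constructor
  · rintro ⟨hp, hmax⟩
    have hl := hp l (Quiver.Path.start_mem_vertices p)
    simp only [segment, Set.mem_ofPred_eq, Nat.cast_le] at hl
    refine ⟨hl.1, hl.2, ?_⟩
    by_contra hc
    rw [not_or, not_not] at hc
    have hl0 := l.pos_lt
    have hl1 : l = vtx o (l.pos - 1 + 1) (by omega) := Vertex.ext_pos (by rw [pos_vtx]; omega)
    obtain ⟨a⟩ : Nonempty (vtx o (l.pos - 1) (by omega) ⟶ l) := by
      have a := upArrow (o := o) (e := l.pos - 1) (by omega) hc.2
      rw [← hl1] at a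
      exact ⟨a⟩
    have hq := path_right (a.toPath.comp p) (by rw [pos_vtx]; omega)
    have h1 := hmax _ (a.toPath.comp p) fun v hv => by
      have := hq.2.2 v hv
      rw [pos_vtx] at this
      simp only [segment, Set.mem_ofPred_eq, Nat.cast_le]
      omega
    rw [Quiver.Path.length_comp, Quiver.Path.length_toPath] at h1
    omega
  · rintro ⟨h1, h2, h3⟩
    obtain ⟨hp1, hp2, hp3⟩ := path_right p h2
    refine ⟨fun v hv => ?_, fun l' q hq => ?_⟩
    · have := hp3 v hv
      simp only [segment, Set.mem_ofPred_eq, Nat.cast_le]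
      omega
    · have hl := hq l' (Quiver.Path.start_mem_vertices q)
      simp only [segment, Set.mem_ofPred_eq, Nat.cast_le] at hl
      obtain ⟨hq1, hq2, -⟩ := path_right q hl.2
      by_contra hlt
      exact h3.elim (by omega) fun h => h (hq2 _ (by omega) (by omega))

/-- A path in `Q(k, J)` which ends in `k` is a longest one if and only if it cannot be extended to
the right. -/
theorem isLongestPathIn_right {l k : Vertex n o} {J : ℕ} (hJ : J < n) (p : Quiver.Path l k) :
    IsLongestPathIn (segment o k.pos J) p ↔
      k.pos ≤ l.pos ∧ l.pos ≤ J ∧ (l.pos = J ∨ IsUp o l.pos) := by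
  constructor
  · rintro ⟨hp, hmax⟩
    have hl := hp l (Quiver.Path.start_mem_vertices p)
    simp only [segment, Set.mem_ofPred_eq, Nat.cast_le] at hl
    refine ⟨hl.1, hl.2, ?_⟩
    by_contra hc
    rw [not_or] at hc
    have a : vtx o (l.pos + 1) (by omega) ⟶ l := dnArrow (o := o) (e := l.pos) (by omega) hc.2
    have hq := path_left (a.toPath.comp p) (by rw [pos_vtx]; omega)
    have h1 := hmax _ (a.toPath.comp p) fun v hv => by
      have := hq.2.2 v hv
      rw [pos_vtx] at this
      simp only [segment, Set.mem_ofPred_eq, Nat.cast_le]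
      omega
    rw [Quiver.Path.length_comp, Quiver.Path.length_toPath] at h1
    omega
  · rintro ⟨h1, h2, h3⟩
    obtain ⟨hp1, hp2, hp3⟩ := path_left p h1
    refine ⟨fun v hv => ?_, fun l' q hq => ?_⟩
    · have := hp3 v hv
      simp only [segment, Set.mem_ofPred_eq, Nat.cast_le]
      omega
    · have hl := hq l' (Quiver.Path.start_mem_vertices q)
      simp only [segment, Set.mem_ofPred_eq, Nat.cast_le] at hl
      obtain ⟨hq1, hq2, -⟩ := path_left q hl.1
      by_contra hlt
      exact h3.elim (by omega) fun h => hq2 _ (by omega) (by omega) h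

variable {K : Type*} [Field K] {d : Vertex n o → ℕ} (V : Rep K d)

theorem longest_eq_along {S : Set (Vertex n o)} {l k : Vertex n o} {p : Quiver.Path l k}
    (hp : IsLongestPathIn S p) : V.longest S k l = V.along p := by
  have h : ∃ p : Quiver.Path l k, IsLongestPathIn S p := ⟨p, hp⟩
  rw [Rep.longest, dif_pos h, Subsingleton.elim h.choose p]

theorem longest_eq_zero {S : Set (Vertex n o)} {l k : Vertex n o}
    (hp : ∀ p : Quiver.Path l k, ¬ IsLongestPathIn S p) : V.longest S k l = 0 :=
  dif_neg fun ⟨p, h⟩ => hp p h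

theorem longest_left_step {e I : ℕ} (h : e + 1 < n) (he : IsUp o e) (hI : I ≤ e)
    (l : Vertex n o) :
    V.longest (segment o I (vtx o (e + 1) h).pos) (vtx o (e + 1) h) l =
      V.map (upArrow h he) ∘ₗ
        V.longest (segment o I (vtx o e (e.lt_succ_self.trans h)).pos)
          (vtx o e (e.lt_succ_self.trans h)) l := by
  by_cases hp : ∃ p : Quiver.Path l (vtx o e (e.lt_succ_self.trans h)),
      IsLongestPathIn (segment o I (vtx o e (e.lt_succ_self.trans h)).pos) p
  · obtain ⟨p, hp⟩ := hp
    have hp' := (isLongestPathIn_left p).1 hp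
    rw [longest_eq_along V hp, longest_eq_along V (p := p.cons (upArrow h he))
      ((isLongestPathIn_left (p.cons (upArrow h he))).2
        ⟨hp'.1, hp'.2.1.trans e.le_succ, hp'.2.2⟩)]
    rfl
  · rw [longest_eq_zero V fun p h => hp ⟨p, h⟩, longest_eq_zero V fun q hq => ?_,
      LinearMap.comp_zero]
    obtain ⟨h1, h2, h3⟩ := (isLongestPathIn_left q).1 hq
    rw [pos_vtx] at h2
    have hle : l.pos ≤ e := by
      by_contra hc
      have h4 : l.pos = e + 1 := by omega
      rw [h4] at h3
      exact h3.elim (by omega) fun h => h he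
    have hq' := path_right q h2
    generalize hk : vtx o (e + 1) h = k at q
    cases q with
    | nil =>
      rw [← hk, pos_vtx] at hle
      omega
    | @cons b _ q a =>
      have hkp : k.pos = e + 1 := by rw [← hk, pos_vtx]
      have hb : b.pos = e := by
        obtain ⟨h4, -⟩ | ⟨h4, h5⟩ := arrow_cases a
        · omega
        · exact (h5 ((path_right q (by omega)).2.1 _ (by omega) (by omega))).elim
      obtain rfl : b = vtx o e (e.lt_succ_self.trans h) := Vertex.ext_pos hb
      exact hp ⟨q, (isLongestPathIn_left q).2 ⟨h1, hle, h3⟩⟩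

theorem longest_right_step {e J : ℕ} (hJ : J < n) (he : ¬ IsUp o e) (hJe : e + 1 ≤ J)
    (l : Vertex n o) :
    V.longest (segment o (vtx o e (by omega)).pos J) (vtx o e (by omega)) l =
      V.map (dnArrow (hJe.trans_lt hJ) he) ∘ₗ
        V.longest (segment o (vtx o (e + 1) (hJe.trans_lt hJ)).pos J)
          (vtx o (e + 1) (hJe.trans_lt hJ)) l := by
  have h := hJe.trans_lt hJ
  by_cases hp : ∃ p : Quiver.Path l (vtx o (e + 1) h),
      IsLongestPathIn (segment o (vtx o (e + 1) h).pos J) p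
  · obtain ⟨p, hp⟩ := hp
    have hp' := (isLongestPathIn_right hJ p).1 hp
    rw [longest_eq_along V hp, longest_eq_along V (p := p.cons (dnArrow h he))
      ((isLongestPathIn_right hJ (p.cons (dnArrow h he))).2
        ⟨e.le_succ.trans hp'.1, hp'.2.1, hp'.2.2⟩)]
    rfl
  · rw [longest_eq_zero V fun p h => hp ⟨p, h⟩, longest_eq_zero V fun q hq => ?_,
      LinearMap.comp_zero]
    obtain ⟨h1, h2, h3⟩ := (isLongestPathIn_right hJ q).1 hq
    rw [pos_vtx] at h1
    have hle : e + 1 ≤ l.pos := by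
      by_contra hc
      have h4 : l.pos = e := by omega
      rw [h4] at h3
      exact h3.elim (by omega) fun h => he h
    generalize hk : vtx o e (e.lt_succ_self.trans h) = k at q
    cases q with
    | nil =>
      rw [← hk, pos_vtx] at hle
      omega
    | @cons b _ q a =>
      have hkp : k.pos = e := by rw [← hk, pos_vtx]
      have hb : b.pos = e + 1 := by
        obtain ⟨h4, h5⟩ | ⟨h4, h5⟩ := arrow_cases a
        · exact ((path_left q (by omega)).2.1 _ le_rfl (by omega) h5).elim
        · omega
      obtain rfl : b = vtx o (e + 1) h := Vertex.ext_pos hb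
      exact hp ⟨q, (isLongestPathIn_right hJ q).2 ⟨hle, h2, h3⟩⟩

end Paths

/-! ### The rank of the block matrix -/

section BlockMatrix

variable {n : ℕ} {o : Fin (n - 1) → Bool}

theorem mem_sources_iff {i j l : Vertex n o} :
    l ∈ sources i j ↔ IsSrc o i.pos j.pos l.pos := by
  simp only [sources, Finset.mem_filter, Finset.mem_univ, true_and, IsSourceIn, segment,
    Set.mem_ofPred_eq, Nat.cast_le]
  have hj := j.pos_lt
  constructor
  · induction l using vtx_induction with
    | h k hk =>
      rw [pos_vtx]
      rintro ⟨⟨h1, h2⟩, h3⟩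
      refine ⟨h1, h2, ?_, ?_⟩
      · by_contra hc
        rw [not_or, not_not] at hc
        obtain ⟨e, rfl⟩ : ∃ e, k = e + 1 := ⟨k - 1, by omega⟩
        exact (h3 (vtx o e (by omega)) (by rw [pos_vtx]; omega)).false (upArrow hk hc.2)
      · by_contra hc
        rw [not_or] at hc
        exact (h3 (vtx o (k + 1) (by omega)) (by rw [pos_vtx]; omega)).false
          (dnArrow (by omega) hc.2)
  · rintro ⟨h1, h2, h3, h4⟩
    refine ⟨⟨h1, h2⟩, fun l' hl' => ⟨fun a => ?_⟩⟩
    obtain ⟨h5, h6⟩ | ⟨h5, h6⟩ := arrow_cases a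
    · rw [h5, Nat.add_sub_cancel] at h3
      exact h3.elim (by omega) fun h => h h6
    · exact h4.elim (by omega) h6

theorem mem_sinks_iff {i j k : Vertex n o} :
    k ∈ sinks i j ↔ IsSnk o i.pos j.pos k.pos := by
  have hne : ∀ v : Vertex n o, k ≠ v ↔ k.pos ≠ v.pos := fun v =>
    not_congr ⟨fun h => by rw [h], Vertex.ext_pos⟩
  rw [sinks, Finset.mem_filter]
  simp only [Finset.mem_univ, true_and, IsSinkIn, segment, Set.mem_ofPred_eq, hne]
  have hj := j.pos_lt
  constructor
  · induction k using vtx_induction with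
    | h k hk =>
      rw [pos_vtx]
      rintro ⟨⟨⟨h1, h2⟩, h3⟩, h4, h5⟩
      refine ⟨by omega, by omega, h4, h5, fun h6 h7 => ?_, fun h6 => ?_⟩
      · exact (h3 (vtx o (k + 1) (by omega)) (by rw [pos_vtx]; omega)).false (upArrow (by omega) h7)
      · obtain ⟨e, rfl⟩ : ∃ e, k = e + 1 := ⟨k - 1, by omega⟩
        by_contra h7
        exact (h3 (vtx o e (by omega)) (by rw [pos_vtx]; omega)).false (dnArrow hk h7)
  · rintro ⟨h1, h2, h3, h4, h5, h6⟩
    refine ⟨⟨by omega, fun l hl => ⟨fun a => ?_⟩⟩, h3, h4⟩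
    obtain ⟨h7, h8⟩ | ⟨h7, h8⟩ := arrow_cases a
    · exact h5 (by omega) h8
    · rw [h7, Nat.add_sub_cancel] at h6
      exact h8 (h6 (by omega))

variable {K : Type*} [Field K] {d : Vertex n o → ℕ} (V : Rep K d)

/-- The transport of the vectors `x l` to `k` along the longest path in `Q(I, k)`. -/
def leftSum (I : ℕ) (x : ∀ v : Vertex n o, Fin (d v) → K) (k : Vertex n o) : Fin (d k) → K :=
  ∑ l, V.longest (segment o I k.pos) k l (x l)

/-- The transport of the vectors `x l` to `k` along the longest path in `Q(k, J)`. -/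
def rightSum (J : ℕ) (x : ∀ v : Vertex n o, Fin (d v) → K) (k : Vertex n o) : Fin (d k) → K :=
  ∑ l, V.longest (segment o k.pos J) k l (x l)

theorem isTransport {I J : ℕ} (hJ : J < n) (x : ∀ v : Vertex n o, Fin (d v) → K) :
    IsTransport o V.toZigzag I J (fun k h => x (vtx o k h.down))
      (fun k h => leftSum V I x (vtx o k h.down)) (fun k h => rightSum V J x (vtx o k h.down)) where
  left_start k hI hk := by
    funext h
    have h0 : V.longest (segment o I (vtx o k h.down).pos) (vtx o k h.down) (vtx o k h.down) =
        V.along Quiver.Path.nil := longest_eq_along V ((isLongestPathIn_left _).2 ⟨hI, le_rfl, hk⟩)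
    rw [leftSum, Finset.sum_eq_single (vtx o k h.down), h0]
    · rfl
    · intro l _ hl
      rw [longest_eq_zero V fun p hp => ?_, LinearMap.zero_apply]
      obtain ⟨h1, h2, h3⟩ := (isLongestPathIn_left p).1 hp
      have h4 : l.pos ≠ k := fun h4 => hl (Vertex.ext_pos h4)
      rw [pos_vtx] at h2
      exact hk.elim (by omega) fun h5 =>
        h5 ((path_right p h2).2.1 (k - 1) (by omega) (by rw [pos_vtx]; omega))
    · exact fun h => (h (Finset.mem_univ _)).elim
  left_step e he hI := by
    funext h
    rw [V.toZigzag_up he, leftSum, leftSum, map_sum]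
    exact Finset.sum_congr rfl fun l _ => by
      rw [longest_left_step V h.down he hI l, LinearMap.comp_apply]
  left_zero k hk := by
    funext h
    refine Finset.sum_eq_zero fun l _ => ?_
    rw [longest_eq_zero V fun p hp => ?_, LinearMap.zero_apply]
    obtain ⟨h1, h2, h3⟩ := (isLongestPathIn_left p).1 hp
    rw [pos_vtx] at h2
    omega
  right_start k hkJ hk := by
    funext h
    have h0 : V.longest (segment o (vtx o k h.down).pos J) (vtx o k h.down) (vtx o k h.down) =
        V.along Quiver.Path.nil :=
      longest_eq_along V ((isLongestPathIn_right hJ _).2 ⟨le_rfl, hkJ, hk⟩)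
    rw [rightSum, Finset.sum_eq_single (vtx o k h.down), h0]
    · rfl
    · intro l _ hl
      rw [longest_eq_zero V fun p hp => ?_, LinearMap.zero_apply]
      obtain ⟨h1, h2, h3⟩ := (isLongestPathIn_right hJ p).1 hp
      have h4 : l.pos ≠ k := fun h4 => hl (Vertex.ext_pos h4)
      rw [pos_vtx] at h1
      exact hk.elim (by omega) fun h5 =>
        (path_left p h1).2.1 k (by rw [pos_vtx]) (by omega) h5
    · exact fun h => (h (Finset.mem_univ _)).elim
  right_step e he heJ := by
    funext h
    rw [V.toZigzag_dn he (heJ.trans_lt hJ), rightSum, rightSum, map_sum]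
    exact Finset.sum_congr rfl fun l _ => by
      rw [longest_right_step V hJ he heJ l, LinearMap.comp_apply]
  right_zero k hk := by
    funext h
    refine Finset.sum_eq_zero fun l _ => ?_
    rw [longest_eq_zero V fun p hp => ?_, LinearMap.zero_apply]
    obtain ⟨h1, h2, h3⟩ := (isLongestPathIn_right hJ p).1 hp
    rw [pos_vtx] at h1
    omega

/-- The extension by zero of a family of vectors at the sources. -/
def extend {i j : Vertex n o} (x : (Σ l : sources i j, Fin (d l)) → K) (v : Vertex n o) :
    Fin (d v) → K :=
  fun q => if h : v ∈ sources i j then x ⟨⟨v, h⟩, q⟩ else 0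

theorem blockMatrix_mulVec {i j : Vertex n o} (x : (Σ l : sources i j, Fin (d l)) → K)
    (k : sinks i j) (p : Fin (d k)) : (blockMatrix V i j).mulVec x ⟨k, p⟩ =
      (leftSum V i.pos (extend x) k + rightSum V j.pos (extend x) k) p := by
  let F : Vertex n o → Fin (d k) → K := fun l =>
    V.longest (segment o i.pos k.1.pos) k l (extend x l) +
      V.longest (segment o k.1.pos j.pos) k l (extend x l)
  have h1 : leftSum V i.pos (extend x) k + rightSum V j.pos (extend x) k = ∑ l, F l :=
    Finset.sum_add_distrib.symm
  have h2 : ∑ l, F l = ∑ l : sources i j, F l := by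
    rw [Finset.sum_coe_sort (sources i j) F]
    refine (Finset.sum_subset (Finset.subset_univ _) fun l _ hl => ?_).symm
    have : extend x l = 0 := funext fun q => dif_neg hl
    simp only [F, this, map_zero, add_zero]
  rw [h1, h2, Matrix.mulVec, dotProduct, Fintype.sum_sigma, Finset.sum_apply]
  refine Finset.sum_congr rfl fun l _ => ?_
  have h3 : extend x l.1 = fun q => x ⟨l, q⟩ := funext fun q => dif_pos l.2
  have h4 := congrFun (LinearMap.toMatrix'_mulVec
    (V.longest (segment o i.pos k.1.pos) k l + V.longest (segment o k.1.pos j.pos) k l)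
    (extend x l.1)) p
  rw [h3, Matrix.mulVec, dotProduct] at h4
  simp only [F, h3]
  exact h4

/-- The nullity of the block matrix is the dimension of the space of homomorphisms from the
interval representation. -/
theorem rankTuple_add_finrank_hom {i j : Vertex n o} (hij : i.pos ≤ j.pos) :
    rankTuple V i j + Module.finrank K ((Rep.interval K i j).Hom V) = ∑ l ∈ sources i j, d l := by
  let A := blockMatrix V i j
  let C := V.toZigzag.closedFamily (IsUp o) (edgeSign K o) i.pos j.pos
  let Φ : C →ₗ[K] ((Σ l : sources i j, Fin (d l)) → K) :=
    { toFun := fun y s => component y.1 s.1.1 s.2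
      map_add' := fun _ _ => rfl
      map_smul' := fun _ _ => rfl }
  have hext : ∀ (y : C) (k : ℕ), IsSrc o i.pos j.pos k →
      (fun h : PLift (k < n) => extend (Φ y) (vtx o k h.down)) = y.1 k := fun y k hk => by
    funext h q
    exact dif_pos (mem_sources_iff.2 hk)
  have hinj : Function.Injective Φ := by
    rw [injective_iff_map_eq_zero]
    intro y hy
    have h0 : ∀ v, extend (Φ y) v = 0 := fun v => by
      rw [hy]
      funext q
      simp [extend]
    have ht := isTransport V (I := i.pos) j.pos_lt (extend (Φ y))
    have hL : (fun (k : ℕ) (h : PLift (k < n)) =>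
        leftSum V i.pos (extend (Φ y)) (vtx o k h.down)) = 0 := by
      funext k h
      exact Finset.sum_eq_zero fun l _ => by rw [h0, map_zero]
    have hR : (fun (k : ℕ) (h : PLift (k < n)) =>
        rightSum V j.pos (extend (Φ y)) (vtx o k h.down)) = 0 := by
      funext k h
      exact Finset.sum_eq_zero fun l _ => by rw [h0, map_zero]
    rw [hL, hR] at ht
    exact Subtype.ext (ht.eq_zero y.2 (hext y))
  have hrange : LinearMap.range Φ = LinearMap.ker A.mulVecLin := by
    ext x
    rw [LinearMap.mem_ker, Matrix.mulVecLin_apply]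
    constructor
    · rintro ⟨y, rfl⟩
      funext ⟨k, p⟩
      rw [blockMatrix_mulVec]
      have ht := (isTransport V (I := i.pos) j.pos_lt (extend (Φ y))).add_eq_zero hij y.2 (hext y)
        (mem_sinks_iff.1 k.2)
      exact congrFun (congrFun ht ⟨k.1.pos_lt⟩) p
    · intro hx
      obtain ⟨y, hy, hyx⟩ := (isTransport V (I := i.pos) j.pos_lt (extend x)).exists_family hij
        fun k hk => by
          funext h p
          have h1 := congrFun hx ⟨⟨vtx o k h.down, mem_sinks_iff.2 hk⟩, p⟩
          rw [blockMatrix_mulVec] at h1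
          exact h1
      refine ⟨⟨y, hy⟩, ?_⟩
      funext ⟨l, q⟩
      have h1 := congrFun (congrFun (hyx l.1.pos (mem_sources_iff.1 l.2)) ⟨l.1.pos_lt⟩) q
      refine h1.trans ?_
      exact dif_pos l.2
  have h1 := LinearMap.finrank_range_add_finrank_ker A.mulVecLin
  have h2 : Module.finrank K (LinearMap.ker A.mulVecLin) =
      Module.finrank K ((Rep.interval K i j).Hom V) := by
    rw [← hrange, LinearMap.finrank_range_of_inj hinj]
    exact (homIntervalEquiv i j V).finrank_eq.symm
  rw [Module.finrank_fintype_fun_eq_card, Fintype.card_sigma, h2] at h1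
  simp only [Fintype.card_fin] at h1
  rw [Finset.sum_coe_sort (sources i j) d] at h1
  exact h1

end BlockMatrix

/-! ### Recognizing the rigid representation -/

section Recognition

variable {K : Type*} [Field K] {n : ℕ} {o : Fin (n - 1) → Bool} {d : Vertex n o → ℕ}

/-- A representation with as many homomorphisms from each interval representation as the rigid one
is isomorphic to it: the flags have the same dimensions as those of the standard representation,
so it is generic, hence rigid. -/
theorem iso_of_finrank_hom_eq [Infinite K] {R V : Rep K d} (hR : R.IsRigid)
    (h : ∀ i j : Vertex n o, i.pos ≤ j.pos →
      Module.finrank K ((Rep.interval K i j).Hom V) =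
        Module.finrank K ((Rep.interval K i j).Hom R)) : V.Iso R := by
  have hstd := standard_isGeneric (K := K) (d := d)
  have hiso : R.Iso (Rep.standard K d) := hR.iso (Rep.isRigid_of_isGeneric hstd)
  have hclosed : ∀ a k, a ≤ k → k < n →
      Module.finrank K (V.toZigzag.closedFamily (IsUp o) (edgeSign K o) a k) =
        Module.finrank K
          ((Rep.standard K d).toZigzag.closedFamily (IsUp o) (edgeSign K o) a k) := by
    intro a k hak hk
    have h1 := h (vtx o a (hak.trans_lt hk)) (vtx o k hk) hak
    rw [Rep.finrank_hom_congr (Rep.Iso.refl _) hiso] at h1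
    exact ((homIntervalEquiv _ _ V).finrank_eq.symm.trans h1).trans
      (homIntervalEquiv (vtx o a _) (vtx o k hk) (Rep.standard K d)).finrank_eq
  have hflag := Zigzag.finrank_flag_eq edgeSign_ne_zero (fun k hk => not_isUp hk) hclosed
  refine Rep.IsRigid.iso (Rep.isRigid_of_isGeneric (Zigzag.isGeneric_iff.2 fun k hk => ?_)) hR
  have h2 := Zigzag.isGeneric_iff.1 hstd k hk
  have h3 := fun {a} (ha : a ≤ k) => hflag k (by omega) ha
  have h4 := fun {a} (ha : a ≤ k + 1) => hflag (k + 1) hk ha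
  refine ⟨fun hb a ha => ?_, fun hb => ⟨?_, fun a ha => ?_⟩⟩
  · rw [h3 ha, h4 (by omega)]
    exact h2.1 hb a ha
  · rw [h4 le_rfl]
    exact (h2.2 hb).1
  · rw [h3 ha, h4 (by omega), h4 le_rfl]
    exact (h2.2 hb).2 a ha

end Recognition

end TypeA

end

theorem mainTheorem3 {K : Type*} [Field K] [IsAlgClosed K] (n : ℕ) (o : Fin (n - 1) → Bool)
    (d : TypeA.Vertex n o → ℕ) :
    (∃ R : TypeA.Rep K d, R.IsRigid) ∧
    ∀ R : TypeA.Rep K d, R.IsRigid → ∀ V : TypeA.Rep K d,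
      (V.Iso R ↔ ∀ i j : TypeA.Vertex n o, i.pos ≤ j.pos →
        (TypeA.rankTuple V i j : ℤ) =
          ∑ l ∈ TypeA.sources i j, (d l : ℤ) - (TypeA.homMin K (TypeA.root i j) d : ℤ)) ∧
      (V.Iso R ↔ ∀ W : TypeA.Rep K d, ∀ i j : TypeA.Vertex n o, i.pos ≤ j.pos →
        TypeA.rankTuple W i j ≤ TypeA.rankTuple V i j) := by
  have : Infinite K := IsAlgClosed.instInfinite
  have hstd := TypeA.Rep.isRigid_of_isGeneric (TypeA.standard_isGeneric (K := K) (d := d))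
  refine ⟨⟨_, hstd⟩, fun R hR V => ?_⟩
  have hrank : ∀ (W : TypeA.Rep K d) {i j : TypeA.Vertex n o}, i.pos ≤ j.pos → _ :=
    fun W i j hij => TypeA.rankTuple_add_finrank_hom W hij
  have hmin : ∀ i j : TypeA.Vertex n o, TypeA.homMin K (TypeA.root i j) d =
      Module.finrank K ((TypeA.Rep.interval K i j).Hom R) := fun i j =>
    (TypeA.interval_isRigid i j).homMin_eq hR
  have hle : ∀ (W : TypeA.Rep K d) (i j : TypeA.Vertex n o),
      Module.finrank K ((TypeA.Rep.interval K i j).Hom R) ≤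
        Module.finrank K ((TypeA.Rep.interval K i j).Hom W) := fun W i j =>
    (TypeA.interval_isRigid i j).finrank_hom_le hR _ W
  have key : V.Iso R ↔ ∀ i j : TypeA.Vertex n o, i.pos ≤ j.pos →
      Module.finrank K ((TypeA.Rep.interval K i j).Hom V) =
        Module.finrank K ((TypeA.Rep.interval K i j).Hom R) :=
    ⟨fun h i j _ => TypeA.Rep.finrank_hom_congr (TypeA.Rep.Iso.refl _) h,
      TypeA.iso_of_finrank_hom_eq hR⟩
  constructor
  · rw [key]
    refine forall_congr' fun i => forall_congr' fun j => imp_congr_right fun hij => ?_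
    have h1 := hrank V hij
    rw [hmin, ← Nat.cast_sum]
    omega
  · rw [key]
    constructor
    · intro h W i j hij
      have h1 := hrank V hij
      have h2 := hrank W hij
      have h3 := h i j hij
      have h4 := hle W i j
      omega
    · intro h i j hij
      have h1 := hrank V hij
      have h2 := hrank R hij
      have h3 := h R i j hij
      have h4 := hle V i j
      omega
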